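/- There are $n$ balls and $n$ bins; $\log$ is the binary logarithm, and $\log^* n$ is the least $t$ such that a tower of $t$ twos is at least $n$. Put $k(1)=1$ and $k(i+1)=\min\{k(i)\,e^{\lfloor k(i)\rfloor/10},\ \log n\}$. The algorithm $\mathcal A_b^2$ proceeds in synchronous rounds $i=1,2,\dots$, each of which consists of three steps: (1) every ball not yet placed sends $\lfloor k(i)\rfloor$ requests to bins chosen uniformly and independently at random (with replacement, independently of everything else); (2) every bin that already holds two balls refuses all requests, and every other bin gives a permission to exactly one of the balls requesting it (if there are any) and declines all other requests; (3) every ball that has received at least one permission is placed into one of the permitting bins, notifies this bin, and terminates. Each request is answered by one message (permission or refusal). The choices left open in steps (2) and (3) may be made by an adversary that knows the past and all requests of the current round, but not future random choices; all constants below are uniform over these choices. "W.h.p." means: for every constant $c>0$, with probability at least $1-1/n^c$ for all sufficiently large $n$, where constants in $\mathcal O(\cdot)$ may depend on $c$. Then: 1. All balls are placed after $\log^* n+\mathcal O(1)$ rounds w.h.p. 2. No bin ever holds more than two balls. 3. W.h.p., in every round at most $n$ requests, at most $n$ answers and at most $n$ notifications are sent. The total number of messages is $\mathcal O(n)$ w.h.p.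 4. Each ball sends and receives $\mathcal O(1)$ messages in expectation; w.h.p. all balls send and receive $\mathcal O(\log n)$ messages. 5. Each bin sends and receives $\mathcal O(1)$ messages in expectation; w.h.p. all bins send and receive $\mathcal O(\log n/\log\log n)$ messages. Furthermore, bins and balls can decide on any request respectively permission immediately, provided that the messages of balls carry round counters: Suppose that the messages belonging to a round (identified by its counter) arrive one after another in an arbitrary, adversarial order, that a bin answers each request at the moment of its arrival, giving a permission if and only if it holds fewer than two balls and has not yet given a permission for this counter, and that a ball is placed into the bin whose permission arrives first. Then 1.--5. hold as well. The messages sent by a ball (counter in binary plus one bit telling requests from notifications) altogether have $\mathcal O(1)$ bits in expectation; in particular messages have size $\mathcal O(1)$ in expectation. W.h.p. all messages sent by balls have size $\mathcal O(\log\log^* n)$. -/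

import Mathlib

open MeasureTheory
open scoped ENNReal

namespace BallsBins

/-- Tower of twos: `1, 2, 4, 16, 65536, …`. -/
def tower : ℕ → ℕ
  | 0 => 1
  | t + 1 => 2 ^ tower t

theorem lt_tower (t : ℕ) : t < tower t := by
  induction t with
  | zero => simp [tower]
  | succ t ih =>
    have h : tower t < 2 ^ tower t := Nat.lt_two_pow_self
    simp only [tower]
    omega

/-- The iterated binary logarithm `log* n`: the least `t` such that a tower of `t` twos is at
least `n`. -/
def logStar (n : ℕ) : ℕ := Nat.find (p := fun t => n ≤ tower t) ⟨n, (lt_tower n).le⟩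

/-! ### The algorithm

There are `n` balls and `n` bins, both indexed by `Fin n`. Rounds are numbered `0, 1, 2, …`
(so index `i` is the `(i+1)`-st round). -/

/-- The real parameter `k` governing the number of requests: `k = 1` in the first round, and then
`k ↦ min (k e^{⌊k⌋/10}) (log₂ n)`. -/
noncomputable def kParam (n : ℕ) : ℕ → ℝ
  | 0 => 1
  | i + 1 => min (kParam n i * Real.exp ((⌊kParam n i⌋₊ : ℝ) / 10)) (Real.logb 2 n)

/-- Number of bins a still unplaced ball contacts in round `i`. -/
noncomputable def numReq (n i : ℕ) : ℕ := ⌊kParam n i⌋₊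

/-- The random choices for round `i`: `D v j` is the bin addressed by the `j`-th request of ball
`v`. (The entries of balls that are already placed are never used.) -/
abbrev Draws (n i : ℕ) : Type := Fin n → Fin (numReq n i) → Fin n

/-- The random choices for all rounds. -/
abbrev Sample (n : ℕ) : Type := (i : ℕ) → Draws n i

/-- All requests are addressed to bins chosen uniformly and independently at random. -/
noncomputable def law (n : ℕ) [NeZero n] : Measure (Sample n) :=
  Measure.infinitePi fun i : ℕ =>
    Measure.pi fun _ : Fin n => Measure.pi fun _ : Fin (numReq n i) =>
      ProbabilityTheory.uniformOn (Set.univ : Set (Fin n))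

/-- The random choices of rounds `0, …, i`. -/
abbrev History (n i : ℕ) : Type := (j : Fin (i + 1)) → Draws n j

/-- The part of the random choices that is known once the requests of round `i` are sent. -/
def Sample.upTo {n : ℕ} (ω : Sample n) (i : ℕ) : History n i := fun j => ω j

/-- The bin in which each ball has been placed so far; `none` for a ball not yet placed. -/
abbrev Placement (n : ℕ) : Type := Fin n → Option (Fin n)

/-- Number of balls in bin `w`. -/
def load {n : ℕ} (P : Placement n) (w : Fin n) : ℕ :=
  (Finset.univ.filter fun v : Fin n => P v = some w).card

/-! #### Synchronous rounds, with arbitrary choices -/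

/-- The choices that the algorithm leaves open: which of the requesting balls a bin admits, and in
which of the permitting bins a ball is placed. They may depend on everything that has happened
so far (including all requests of the current round), but not on future random choices. -/
structure ChoiceRule (n : ℕ) where
  /-- the ball admitted in round `i` by bin `w`, out of a set of requesting balls -/
  grant : (i : ℕ) → History n i → Fin n → Finset (Fin n) → Fin n
  grant_mem : ∀ i h w A, A.Nonempty → grant i h w A ∈ A
  /-- the bin chosen in round `i` by ball `v`, out of a set of permitting bins -/
  choose : (i : ℕ) → History n i → Fin n → Finset (Fin n) → Fin n
  choose_mem : ∀ i h v B, B.Nonempty → choose i h v B ∈ B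

/-- The unplaced balls that send a request to bin `w`. -/
noncomputable def requesters {n i : ℕ} (P : Placement n) (D : Draws n i) (w : Fin n) : Finset (Fin n) :=
  Finset.univ.filter fun v => P v = none ∧ ∃ j, D v j = w

/-- The ball (if any) that receives the permission of bin `w`: a bin with two balls refuses all
requests, any other bin admits exactly one of the requesting balls, if there are any. -/
noncomputable def admitted {n : ℕ} (σ : ChoiceRule n) (i : ℕ) (h : History n i) (P : Placement n)
    (D : Draws n i) (w : Fin n) : Option (Fin n) :=
  if load P w < 2 ∧ (requesters P D w).Nonempty then some (σ.grant i h w (requesters P D w))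
  else none

/-- The bins permitting ball `v`. -/
noncomputable def permitting {n : ℕ} (σ : ChoiceRule n) (i : ℕ) (h : History n i) (P : Placement n)
    (D : Draws n i) (v : Fin n) : Finset (Fin n) :=
  Finset.univ.filter fun w => admitted σ i h P D w = some v

/-- One synchronous round. -/
noncomputable def step {n : ℕ} (σ : ChoiceRule n) (i : ℕ) (h : History n i) (P : Placement n)
    (D : Draws n i) : Placement n := fun v =>
  if P v = none ∧ (permitting σ i h P D v).Nonempty then
    some (σ.choose i h v (permitting σ i h P D v))
  else P v

/-- The placement at the beginning of round `i` (that is, after `i` rounds). -/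
noncomputable def run {n : ℕ} (σ : ChoiceRule n) (ω : Sample n) : ℕ → Placement n
  | 0 => fun _ => none
  | i + 1 => step σ i (ω.upTo i) (run σ ω i) (ω i)

/-! #### Immediate decisions

Messages carry round counters, and they arrive one after another, in an arbitrary order. Bins
answer every request and balls react to every permission at the moment of its arrival. -/

/-- An adversarial order of arrival of the messages of each round (identified by its counter),
which may depend on everything that has happened so far, but not on future random choices.
`requestOrder` lists the requests `(v, j)` (ball, index), `replyOrder` lists the bins in the order
in which their permissions, if any, arrive at the balls. Requests of balls that are already
placed are not sent and are skipped. As a bin's answer depends only on the requests that have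
arrived, and a ball's reaction only on the permissions that have arrived, it is immaterial how
the two orders are interleaved. -/
structure Schedule (n : ℕ) where
  requestOrder : (i : ℕ) → History n i → List (Fin n × Fin (numReq n i))
  requestOrder_nodup : ∀ i h, (requestOrder i h).Nodup
  mem_requestOrder : ∀ i h r, r ∈ requestOrder i h
  replyOrder : (i : ℕ) → History n i → List (Fin n)
  replyOrder_nodup : ∀ i h, (replyOrder i h).Nodup
  mem_replyOrder : ∀ i h w, w ∈ replyOrder i h

/-- Arrival of a request with the current counter at its bin `w`: the bin at once gives its
permission if it has not yet done so for this counter and holds fewer than two balls; otherwise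
it declines at once. `g w` is the ball that has the permission of `w` for this counter. (A bin that
receives a ball with this counter has already given its permission for it, hence it suffices to
count the balls placed with smaller counters.) -/
noncomputable def binReceives {n i : ℕ} (P : Placement n) (D : Draws n i) (g : Fin n → Option (Fin n))
    (r : Fin n × Fin (numReq n i)) : Fin n → Option (Fin n) :=
  if P r.1 = none ∧ g (D r.1 r.2) = none ∧ load P (D r.1 r.2) < 2 then
    Function.update g (D r.1 r.2) (some r.1)
  else g

/-- Arrival of the permission of bin `w` (if it has given one) at the ball: a ball that is not yet
placed is placed into `w` at once. -/
noncomputable def ballReceives {n : ℕ} (g : Fin n → Option (Fin n)) (Q : Placement n) (w : Fin n) :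
    Placement n :=
  match g w with
  | none => Q
  | some v => if Q v = none then Function.update Q v (some w) else Q

/-- All arrivals of round `i`. -/
noncomputable def asyncStep {n : ℕ} (τ : Schedule n) (i : ℕ) (h : History n i) (P : Placement n)
    (D : Draws n i) : Placement n :=
  (τ.replyOrder i h).foldl
    (ballReceives ((τ.requestOrder i h).foldl (binReceives P D) fun _ => none)) P

/-- The placement at the beginning of round `i` if all decisions are immediate. -/
noncomputable def asyncRun {n : ℕ} (τ : Schedule n) (ω : Sample n) : ℕ → Placement n
  | 0 => fun _ => none
  | i + 1 => asyncStep τ i (ω.upTo i) (asyncRun τ ω i) (ω i)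

/-! ### Messages

Every unplaced ball sends its requests, the contacted bin answers every request by a permission
or a refusal, and a ball informs the bin into which it is placed. -/

/-- Requests sent by ball `v` in round `i` (and answers received by it). -/
noncomputable def requestsOf {n : ℕ} (P : ℕ → Placement n) (v : Fin n) (i : ℕ) : ℕ :=
  if P i v = none then numReq n i else 0

/-- Notifications sent by ball `v` in round `i`, namely one if it is placed in this round. -/
def noticesOf {n : ℕ} (P : ℕ → Placement n) (v : Fin n) (i : ℕ) : ℕ :=
  if P i v = none ∧ P (i + 1) v ≠ none then 1 else 0

/-- Requests received by bin `w` in round `i` (and answers sent by it). -/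
noncomputable def requestsAt {n : ℕ} (P : ℕ → Placement n) (ω : Sample n) (w : Fin n) (i : ℕ) : ℕ :=
  (Finset.univ.filter fun r : Fin n × Fin (numReq n i) =>
    P i r.1 = none ∧ ω i r.1 r.2 = w).card

/-- Notifications received by bin `w` in round `i`. -/
def noticesAt {n : ℕ} (P : ℕ → Placement n) (w : Fin n) (i : ℕ) : ℕ :=
  (Finset.univ.filter fun v : Fin n => P i v = none ∧ P (i + 1) v = some w).card

/-- Number of messages sent by ball `v` during the whole execution. -/
noncomputable def ballSent {n : ℕ} (P : ℕ → Placement n) (v : Fin n) : ℝ≥0∞ :=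
  ∑' i, ((requestsOf P v i + noticesOf P v i : ℕ) : ℝ≥0∞)

/-- Number of messages received by ball `v` during the whole execution. -/
noncomputable def ballReceived {n : ℕ} (P : ℕ → Placement n) (v : Fin n) : ℝ≥0∞ :=
  ∑' i, (requestsOf P v i : ℝ≥0∞)

/-- Number of messages sent by bin `w` during the whole execution. -/
noncomputable def binSent {n : ℕ} (P : ℕ → Placement n) (ω : Sample n) (w : Fin n) : ℝ≥0∞ :=
  ∑' i, (requestsAt P ω w i : ℝ≥0∞)

/-- Number of messages received by bin `w` during the whole execution. -/
noncomputable def binReceived {n : ℕ} (P : ℕ → Placement n) (ω : Sample n) (w : Fin n) : ℝ≥0∞ :=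
  ∑' i, ((requestsAt P ω w i + noticesAt P w i : ℕ) : ℝ≥0∞)

/-- Number of all messages sent during the whole execution. -/
noncomputable def totalSent {n : ℕ} (P : ℕ → Placement n) (ω : Sample n) : ℝ≥0∞ :=
  ∑ v, ballSent P v + ∑ w, binSent P ω w

/-- Size in bits of a message of a ball that carries the counter of round `i`: the binary length
of the number of the round, and one bit telling requests from notifications. -/
def messageSize (i : ℕ) : ℕ := Nat.size (i + 1) + 1

/-- Total number of bits sent by ball `v` during the whole execution. -/
noncomputable def ballBits {n : ℕ} (P : ℕ → Placement n) (v : Fin n) : ℝ≥0∞ :=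
  ∑' i, (((requestsOf P v i + noticesOf P v i) * messageSize i : ℕ) : ℝ≥0∞)

/-! ### The guarantees

`S n` is the set of all adversarial behaviours with `n` balls and bins; all bounds are uniform
over it. -/

/-- With high probability: for every `c > 0`, with probability at least `1 - 1/n^c` for all large
`n`. The constant `C` hidden in an `O(·)` of the event may depend on `c`. -/
def Whp {S : ℕ → Type} (A : (C : ℕ) → (n : ℕ) → S n → Set (Sample n)) : Prop :=
  ∀ c : ℝ, 0 < c → ∃ C n₀ : ℕ, ∀ (n : ℕ) [NeZero n], n₀ ≤ n → ∀ s : S n,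
    1 - 1 / (n : ℝ) ^ c ≤ (law n).real (A C n s)

/-- A quantity attached to each ball (or bin) is `O(1)` in expectation. -/
def BoundedExpectation {S : ℕ → Type} (X : (n : ℕ) → S n → Fin n → Sample n → ℝ≥0∞) : Prop :=
  ∃ C n₀ : ℕ, ∀ (n : ℕ) [NeZero n], n₀ ≤ n → ∀ (s : S n) (v : Fin n),
    ∫⁻ ω, X n s v ω ∂(law n) ≤ C

/-- The guarantees on time, load and number of messages, for an algorithm for which
`R n s ω i` is the placement after `i` rounds. -/
structure Guarantees (S : ℕ → Type) (R : (n : ℕ) → S n → Sample n → ℕ → Placement n) : Prop where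
  /-- all balls are placed within `log* n + O(1)` rounds w.h.p. -/
  rounds : Whp (S := S) fun C n s => {ω | ∀ v, R n s ω (logStar n + C) v ≠ none}
  /-- no bin ever holds more than two balls -/
  maxLoad : ∀ (n : ℕ) (s : S n) (ω : Sample n) (i : ℕ) (w : Fin n), load (R n s ω i) w ≤ 2
  /-- w.h.p., in every round at most `n` requests, at most `n` answers and at most `n`
  notifications are sent -/
  perRound : Whp (S := S) fun _ n s => {ω | ∀ i,
    ∑ v, requestsOf (R n s ω) v i ≤ n ∧ ∑ w, requestsAt (R n s ω) ω w i ≤ n ∧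
      ∑ v, noticesOf (R n s ω) v i ≤ n}
  /-- `O(n)` messages in total w.h.p. -/
  total : Whp (S := S) fun C n s => {ω | totalSent (R n s ω) ω ≤ (C * n : ℕ)}
  ballSent_exp : BoundedExpectation (S := S) fun n s v ω => ballSent (R n s ω) v
  ballReceived_exp : BoundedExpectation (S := S) fun n s v ω => ballReceived (R n s ω) v
  /-- every ball sends and receives `O(log n)` messages w.h.p. -/
  ball_whp : Whp (S := S) fun C n s => {ω | ∀ v,
    ballSent (R n s ω) v ≤ ENNReal.ofReal (C * Real.logb 2 n) ∧
      ballReceived (R n s ω) v ≤ ENNReal.ofReal (C * Real.logb 2 n)}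
  binSent_exp : BoundedExpectation (S := S) fun n s w ω => binSent (R n s ω) ω w
  binReceived_exp : BoundedExpectation (S := S) fun n s w ω => binReceived (R n s ω) ω w
  /-- every bin sends and receives `O(log n / log log n)` messages w.h.p. -/
  bin_whp : Whp (S := S) fun C n s => {ω | ∀ w,
    binSent (R n s ω) ω w ≤ ENNReal.ofReal (C * (Real.logb 2 n / Real.logb 2 (Real.logb 2 n))) ∧
      binReceived (R n s ω) ω w ≤
        ENNReal.ofReal (C * (Real.logb 2 n / Real.logb 2 (Real.logb 2 n)))}

/-- The guarantees on the size of the messages of balls, which carry round counters. -/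
structure SmallMessages (S : ℕ → Type) (R : (n : ℕ) → S n → Sample n → ℕ → Placement n) :
    Prop where
  /-- the messages of a ball altogether have `O(1)` bits in expectation -/
  size_exp : BoundedExpectation (S := S) fun n s v ω => ballBits (R n s ω) v
  /-- all messages have size `O(log log* n)` w.h.p. -/
  size_whp : Whp (S := S) fun C n s => {ω | ∀ i v,
    0 < requestsOf (R n s ω) v i + noticesOf (R n s ω) v i →
      (messageSize i : ℝ) ≤ C * Real.logb 2 (logStar n)}

end BallsBins

/-!
Both variants of the algorithm are instances of `BallsBins.IsExecution`. Its essential property is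
`competitor`: a contacted bin with fewer than two balls permits some ball, which is then placed.
Everything is proved for executions in this sense.

Consider a round with `u` unplaced balls that send `K` requests each. If all balls of a set `X` fail,
then all their requests go to bins that are full or requested by unplaced balls outside `X`. This
set of bins does not depend on the requests of the balls in `X`, and has at most
`(n - u) / 2 + K (u - |X|)` elements, whatever the adversary does; this bounds the probability that
`X` fails (`reqLaw_subset_unplaced_le`). No independence between the failures of different balls is
needed: the union bound over `X` controls the first seven rounds, where `K = 1`, and shrinks the
fraction of unplaced balls to `12%` (`reqLaw_lt_unplaced_le_of_numReq_eq_one`). From then on there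
are at most `n / 4` requests, so that `X` fails with probability at most `(3/4)^(K |X|)`. Summing over
all `X` with weights yields the moment generating function of a binomial distribution, and hence
Chernoff's bound for the number of remaining balls (`reqLaw_lt_unplaced_le_of_four_mul_le`). As
`(3/4)^K` is smaller than the factor `e^(-K/10)` by which the parameter `k` grows, the number of all
requests even decreases geometrically, until fewer than `n / (log n)^2` balls are left
(`unplacedBound`, `law_exists_unplacedBound_lt_le`).

The parameter grows like a tower of twos and is equal to `log n` after `log* n + O(1)` rounds
(`exists_saturation`). Then each ball fails with probability at most `(3/4)^⌊log n⌋` per round, so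
that a constant number of further rounds suffices (`law_compl_typical_le`). In such typical
executions, the bounds on rounds and messages hold deterministically, except for the number of
messages at a bin. For these, the moment generating function of the number of requests at a bin is
estimated round by round, with base `√(log n)` (`lintegral_pow_sum_requestsAt_le`).

For the expectations, executions that are not typical have to be considered as well. They are
superpolynomially unlikely, and in every round some ball is placed with probability at least `1/2`,
hence the number of rounds has a geometric tail with rate of order `1/n`
(`law_unplaced_nonempty_le`); together this makes their contribution negligible
(`law_eq_none_le`, `lintegral_ballBits_le`).
-/

namespace BallsBins

/-! ### Executions -/

/-- The properties of the placements that the analysis uses, both for synchronous rounds and for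
immediate decisions. -/
structure IsExecution {n : ℕ} (P : Sample n → ℕ → Placement n) : Prop where
  /-- the placement after `i` rounds does not depend on the random choices of later rounds -/
  adapted : ∀ i ω ω', (∀ j < i, ω j = ω' j) → P ω i = P ω' i
  placed_succ : ∀ ω i v, P ω i v ≠ none → P ω (i + 1) v = P ω i v
  load_le : ∀ ω i w, load (P ω i) w ≤ 2
  requested : ∀ ω i v w, P ω i v = none → P ω (i + 1) v = some w → ∃ j, ω i v j = w
  /-- if a ball that contacts a bin with fewer than two balls is not placed, then the bin permits
  another ball, which is placed (possibly elsewhere) -/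
  competitor : ∀ ω i v j, P ω (i + 1) v = none → load (P ω i) (ω i v j) < 2 →
    ∃ v', P ω i v' = none ∧ P ω (i + 1) v' ≠ none ∧ ∃ j', ω i v' j' = ω i v j

theorem Sample.upTo_congr {n : ℕ} {ω ω' : Sample n} {i : ℕ} (h : ∀ j < i + 1, ω j = ω' j) :
    ω.upTo i = ω'.upTo i := by
  funext j
  exact h j j.2

/-- A round in which every bin with fewer than two balls accepts at most one ball leaves all loads
at most two. -/
theorem load_le_two_of_round {n : ℕ} {P Q : Placement n} (hP : ∀ w, load P w ≤ 2)
    (g : Fin n → Option (Fin n)) (hold : ∀ v, P v ≠ none → Q v = P v)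
    (hnew : ∀ v w, P v = none → Q v = some w → g w = some v ∧ load P w < 2) (w : Fin n) :
    load Q w ≤ 2 := by
  by_cases hw : load P w < 2
  · have hsub : (Finset.univ.filter fun v => Q v = some w) ⊆
        (Finset.univ.filter fun v => P v = some w) ∪
          (Finset.univ.filter fun v => g w = some v) := by
      intro v hv
      simp only [Finset.mem_filter, Finset.mem_univ, true_and, Finset.mem_union] at hv ⊢
      by_cases hPv : P v = none
      · exact Or.inr (hnew v w hPv hv).1
      · exact Or.inl (by rw [← hold v hPv]; exact hv)
    have h1 : (Finset.univ.filter fun v => g w = some v).card ≤ 1 := by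
      rw [Finset.card_le_one]
      intro a ha b hb
      simp only [Finset.mem_filter, Finset.mem_univ, true_and] at ha hb
      exact Option.some.inj (ha.symm.trans hb)
    have h2 := (Finset.card_le_card hsub).trans (Finset.card_union_le _ _)
    unfold load at hw ⊢
    omega
  · refine le_trans (Finset.card_le_card ?_) (hP w)
    intro v hv
    simp only [Finset.mem_filter, Finset.mem_univ, true_and] at hv ⊢
    by_cases hPv : P v = none
    · exact absurd (hnew v w hPv hv).2 hw
    · rw [← hold v hPv]; exact hv

/-! ### Synchronous rounds -/

section Sync

variable {n : ℕ} (σ : ChoiceRule n)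

theorem step_of_placed {i : ℕ} {h : History n i} {P : Placement n} {D : Draws n i} {v : Fin n}
    (hv : P v ≠ none) : step σ i h P D v = P v := by
  simp [step, hv]

theorem admitted_of_step {i : ℕ} {h : History n i} {P : Placement n} {D : Draws n i} {v w : Fin n}
    (hv : P v = none) (hw : step σ i h P D v = some w) : admitted σ i h P D w = some v := by
  unfold step at hw
  split_ifs at hw with hc
  · have hm := σ.choose_mem i h v _ hc.2
    rw [Option.some.inj hw] at hm
    simpa [permitting] using hm
  · rw [hv] at hw; cases hw

theorem admitted_eq_some {i : ℕ} {h : History n i} {P : Placement n} {D : Draws n i} {v w : Fin n}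
    (hw : admitted σ i h P D w = some v) :
    load P w < 2 ∧ P v = none ∧ ∃ j, D v j = w := by
  unfold admitted at hw
  split_ifs at hw with hc
  have hm := σ.grant_mem i h w _ hc.2
  rw [Option.some.inj hw] at hm
  exact ⟨hc.1, by simpa [requesters] using hm⟩

theorem isExecution_run : IsExecution (run σ) where
  adapted i := by
    induction i with
    | zero => intro _ _ _; rfl
    | succ i ih =>
      intro ω ω' h
      simp only [run]
      rw [Sample.upTo_congr h, ih ω ω' fun j hj => h j (by omega), h i (by omega)]
  placed_succ ω i v hv := step_of_placed σ hv
  load_le ω i := by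
    induction i with
    | zero => intro w; simp [load, run]
    | succ i ih =>
      refine load_le_two_of_round ih (admitted σ i (ω.upTo i) (run σ ω i) (ω i))
        (fun v hv => step_of_placed σ hv) fun v w hv hw => ?_
      have := admitted_of_step σ hv hw
      exact ⟨this, (admitted_eq_some σ this).1⟩
  requested ω i v w hv hw := (admitted_eq_some σ (admitted_of_step σ hv hw)).2.2
  competitor ω i v j hv hw := by
    have hv0 : run σ ω i v = none := by
      by_contra h
      rw [show run σ ω (i + 1) v = run σ ω i v from step_of_placed σ h] at hv
      exact h hv
    have hne : (requesters (run σ ω i) (ω i) (ω i v j)).Nonempty :=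
      ⟨v, by simp [requesters, hv0]⟩
    have had : admitted σ i (ω.upTo i) (run σ ω i) (ω i) (ω i v j) =
        some (σ.grant i (ω.upTo i) (ω i v j) (requesters (run σ ω i) (ω i) (ω i v j))) := by
      simp only [admitted, hw, hne, and_self, if_true]
    obtain ⟨-, h1, h2⟩ := admitted_eq_some σ had
    refine ⟨_, h1, ?_, h2⟩
    have hp : (permitting σ i (ω.upTo i) (run σ ω i) (ω i)
        (σ.grant i (ω.upTo i) (ω i v j) (requesters (run σ ω i) (ω i) (ω i v j)))).Nonempty :=
      ⟨ω i v j, by simp [permitting, had]⟩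
    simp [run, step, h1, hp]

end Sync

/-! ### Immediate decisions -/

section Async

variable {n : ℕ}

/-- The permissions given during a round: bin `w` permits only a requesting unplaced ball, and
only if its load is below two. -/
theorem foldl_binReceives_some {i : ℕ} {P : Placement n} {D : Draws n i}
    (l : List (Fin n × Fin (numReq n i))) (g : Fin n → Option (Fin n))
    (hg : ∀ w v, g w = some v → load P w < 2 ∧ P v = none ∧ ∃ j, D v j = w) :
    ∀ w v, l.foldl (binReceives P D) g w = some v →
      load P w < 2 ∧ P v = none ∧ ∃ j, D v j = w := by
  induction l generalizing g with
  | nil => exact hg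
  | cons r l ih =>
    refine ih _ fun w v hw => ?_
    unfold binReceives at hw
    split_ifs at hw with hc
    · by_cases hwr : w = D r.1 r.2
      · subst hwr
        rw [Function.update_self] at hw
        cases hw
        exact ⟨hc.2.2, hc.1, r.2, rfl⟩
      · rw [Function.update_of_ne hwr] at hw
        exact hg w v hw
    · exact hg w v hw

theorem foldl_binReceives_ne_none_of_ne_none {i : ℕ} {P : Placement n} {D : Draws n i}
    (l : List (Fin n × Fin (numReq n i))) (g : Fin n → Option (Fin n)) {w : Fin n}
    (hg : g w ≠ none) : l.foldl (binReceives P D) g w ≠ none := by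
  induction l generalizing g with
  | nil => exact hg
  | cons r l ih =>
    refine ih _ ?_
    unfold binReceives
    split_ifs with hc
    · by_cases hwr : w = D r.1 r.2
      · subst hwr; simp
      · rwa [Function.update_of_ne hwr]
    · exact hg

theorem foldl_binReceives_ne_none {i : ℕ} {P : Placement n} {D : Draws n i}
    (l : List (Fin n × Fin (numReq n i))) (g : Fin n → Option (Fin n))
    {r : Fin n × Fin (numReq n i)} (hr : r ∈ l) (hv : P r.1 = none)
    (hw : load P (D r.1 r.2) < 2) : l.foldl (binReceives P D) g (D r.1 r.2) ≠ none := by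
  induction l generalizing g with
  | nil => simp at hr
  | cons r' l ih =>
    rcases List.mem_cons.1 hr with rfl | hr
    · refine foldl_binReceives_ne_none_of_ne_none l _ ?_
      unfold binReceives
      split_ifs with hc
      · simp
      · intro h
        exact hc ⟨hv, h, hw⟩
    · exact ih _ hr

theorem ballReceives_of_placed {g : Fin n → Option (Fin n)} {Q : Placement n} {w v : Fin n}
    (hv : Q v ≠ none) : ballReceives g Q w v = Q v := by
  unfold ballReceives
  cases hg : g w with
  | none => rfl
  | some v' =>
    dsimp only
    split_ifs with hc
    · rw [Function.update_of_ne]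
      rintro rfl
      exact hv hc
    · rfl

theorem foldl_ballReceives_of_placed {g : Fin n → Option (Fin n)} (l : List (Fin n))
    {Q : Placement n} {v : Fin n} (hv : Q v ≠ none) : l.foldl (ballReceives g) Q v = Q v := by
  induction l generalizing Q with
  | nil => rfl
  | cons w l ih =>
    have h := ballReceives_of_placed (g := g) (w := w) hv
    rw [List.foldl_cons, ih (by rwa [h]), h]

theorem foldl_ballReceives_ne_none {g : Fin n → Option (Fin n)} (l : List (Fin n))
    {Q : Placement n} {v w : Fin n} (hw : w ∈ l) (hg : g w = some v) :
    l.foldl (ballReceives g) Q v ≠ none := by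
  induction l generalizing Q with
  | nil => simp at hw
  | cons w' l ih =>
    rcases List.mem_cons.1 hw with rfl | hw
    · have h : ballReceives g Q w v ≠ none := by
        unfold ballReceives
        rw [hg]
        dsimp only
        split_ifs with hc
        · simp
        · exact hc
      rw [List.foldl_cons, foldl_ballReceives_of_placed l h]
      exact h
    · exact ih hw

theorem foldl_ballReceives_some {g : Fin n → Option (Fin n)} (l : List (Fin n))
    {Q : Placement n} {v w : Fin n} (hv : Q v = none) (hw : l.foldl (ballReceives g) Q v = some w) :
    g w = some v := by
  induction l generalizing Q with
  | nil => rw [List.foldl_nil, hv] at hw; cases hw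
  | cons w' l ih =>
    by_cases hQ : ballReceives g Q w' v = none
    · exact ih hQ hw
    · rw [List.foldl_cons, foldl_ballReceives_of_placed l hQ] at hw
      unfold ballReceives at hw
      cases hg : g w' with
      | none => rw [hg] at hw; simp [hv] at hw
      | some v' =>
        rw [hg] at hw
        dsimp only at hw
        split_ifs at hw with hc
        · by_cases hvv : v = v'
          · subst hvv
            rw [Function.update_self] at hw
            cases hw
            exact hg
          · rw [Function.update_of_ne hvv, hv] at hw; cases hw
        · rw [hv] at hw; cases hw

variable (τ : Schedule n)

theorem isExecution_asyncRun : IsExecution (asyncRun τ) where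
  adapted i := by
    induction i with
    | zero => intro _ _ _; rfl
    | succ i ih =>
      intro ω ω' h
      simp only [asyncRun]
      rw [Sample.upTo_congr h, ih ω ω' fun j hj => h j (by omega), h i (by omega)]
  placed_succ ω i v hv := foldl_ballReceives_of_placed _ hv
  load_le ω i := by
    induction i with
    | zero => intro w; simp [load, asyncRun]
    | succ i ih =>
      refine load_le_two_of_round ih ((τ.requestOrder i (ω.upTo i)).foldl
        (binReceives (asyncRun τ ω i) (ω i)) fun _ => none)
        (fun v hv => foldl_ballReceives_of_placed _ hv) fun v w hv hw => ?_
      have := foldl_ballReceives_some _ hv hw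
      exact ⟨this, (foldl_binReceives_some _ _ (by simp) w v this).1⟩
  requested ω i v w hv hw :=
    (foldl_binReceives_some _ _ (by simp) w v (foldl_ballReceives_some _ hv hw)).2.2
  competitor ω i v j hv hw := by
    have hv0 : asyncRun τ ω i v = none := by
      by_contra h
      rw [show asyncRun τ ω (i + 1) v = asyncRun τ ω i v from foldl_ballReceives_of_placed _ h] at hv
      exact h hv
    have hne := foldl_binReceives_ne_none (D := ω i) (τ.requestOrder i (ω.upTo i)) (fun _ => none)
      (τ.mem_requestOrder i (ω.upTo i) (v, j)) hv0 hw
    obtain ⟨v', hv'⟩ := Option.ne_none_iff_exists'.1 hne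
    obtain ⟨-, h1, h2⟩ := foldl_binReceives_some _ _ (by simp) _ v' hv'
    exact ⟨v', h1, foldl_ballReceives_ne_none _ (τ.mem_replyOrder i (ω.upTo i) _) hv', h2⟩

end Async

/-! ### The random requests -/

/-- The law of the requests of one round in which every ball sends `K` requests. -/
noncomputable def reqLaw (n K : ℕ) : Measure (Fin n → Fin K → Fin n) :=
  Measure.pi fun _ => Measure.pi fun _ => ProbabilityTheory.uniformOn Set.univ

theorem uniformOn_univ_finset {n : ℕ} (T : Finset (Fin n)) :
    ProbabilityTheory.uniformOn (Set.univ : Set (Fin n)) (T : Set (Fin n)) = (T.card : ℝ≥0∞) / n := by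
  rw [ProbabilityTheory.uniformOn_univ, Measure.count_apply_finset, Fintype.card_fin]

theorem reqLaw_forall_mem {n K : ℕ} (T : Fin n → Fin K → Finset (Fin n)) :
    reqLaw n K {D | ∀ v j, D v j ∈ T v j} = ∏ v, ∏ j, ((T v j).card : ℝ≥0∞) / n := by
  have h : {D : Fin n → Fin K → Fin n | ∀ v j, D v j ∈ T v j} =
      Set.univ.pi fun v => Set.univ.pi fun j => (T v j : Set (Fin n)) := by
    ext D; simp [Set.mem_pi]
  rw [h, reqLaw, Measure.pi_pi]
  refine Finset.prod_congr rfl fun v _ => ?_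
  rw [Measure.pi_pi]
  exact Finset.prod_congr rfl fun j _ => uniformOn_univ_finset _

section ReqLaw

variable {n : ℕ} [NeZero n] {K : ℕ}

instance : IsProbabilityMeasure (reqLaw n K) := by
  unfold reqLaw; infer_instance

instance : IsProbabilityMeasure (law n) := by
  unfold law; infer_instance

theorem reqLaw_forall_eq (R : Finset (Fin n × Fin K)) (w : Fin n) :
    reqLaw n K {D | ∀ r ∈ R, D r.1 r.2 = w} = ((n : ℝ≥0∞)⁻¹) ^ R.card := by
  have h : {D : Fin n → Fin K → Fin n | ∀ r ∈ R, D r.1 r.2 = w} =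
      {D | ∀ v j, D v j ∈ (if (v, j) ∈ R then {w} else Finset.univ : Finset (Fin n))} := by
    ext D
    simp only [Set.mem_ofPred_eq, Prod.forall]
    refine forall₂_congr fun v j => ?_
    split_ifs with hr <;> simp [hr]
  have hn : (n : ℝ≥0∞) / n = 1 := ENNReal.div_self (by simp [NeZero.ne n]) (by simp)
  rw [h, reqLaw_forall_mem, ← Fintype.prod_prod_type']
  have : ∀ r : Fin n × Fin K,
      (((if r ∈ R then {w} else Finset.univ : Finset (Fin n)).card : ℕ) : ℝ≥0∞) / n =
      if r ∈ R then (n : ℝ≥0∞)⁻¹ else 1 := by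
    intro r
    split_ifs
    · simp
    · simp [hn]
  simp only [Prod.mk.eta, this]
  rw [Finset.prod_ite, Finset.prod_const, Finset.prod_const_one, mul_one]
  simp

/-- Conditionally on the requests of the balls outside `X`, a set `T` of at most `t` bins that
depends only on those requests contains all requests of the balls in `X` with probability at most
`(t/n)^{K |X|}`. -/
theorem reqLaw_forall_mem_le (X : Finset (Fin n)) (T : (Fin n → Fin K → Fin n) → Finset (Fin n))
    (hT : ∀ D D', (∀ v, v ∉ X → D v = D' v) → T D = T D') {t : ℝ≥0∞}
    (ht : ∀ D, ((T D).card : ℝ≥0∞) ≤ t) :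
    reqLaw n K {D | ∀ v ∈ X, ∀ j, D v j ∈ T D} ≤ (t / n) ^ (K * X.card) := by
  -- the predicate is written with `decide` to have only one `Fintype` instance on its subtype
  have hmp := measurePreserving_piEquivPiSubtypeProd
    (fun _ : Fin n => Measure.pi fun _ : Fin K =>
      ProbabilityTheory.uniformOn (Set.univ : Set (Fin n))) (fun v => decide (v ∈ X) = true)
  set e := MeasurableEquiv.piEquivPiSubtypeProd (fun _ : Fin n => Fin K → Fin n)
    (fun v => decide (v ∈ X) = true) with he
  set S := {D : Fin n → Fin K → Fin n | ∀ v ∈ X, ∀ j, D v j ∈ T D}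
  have hS := ((MeasurePreserving.symm e hmp).measure_preimage_equiv S).symm
  change reqLaw n K S = _ at hS
  rw [hS, Measure.prod_apply_symm (by exact Set.Finite.measurableSet (Set.toFinite _))]
  refine (lintegral_mono (g := fun _ => (t / n) ^ (K * X.card)) fun y => ?_).trans (by simp)
  obtain ⟨D₀, hD₀⟩ : ∃ D : Fin n → Fin K → Fin n,
      ∀ v (h : ¬ decide (v ∈ X) = true), D v = y ⟨v, h⟩ :=
    ⟨fun v => if h : ¬ decide (v ∈ X) = true then y ⟨v, h⟩ else fun _ => 0,
      fun v h => dif_pos h⟩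
  have hsub : (fun x => (x, y)) ⁻¹' (e.symm ⁻¹' S) ⊆
      Set.univ.pi fun _ => Set.univ.pi fun _ => (T D₀ : Set (Fin n)) := by
    intro x hx
    have hTx : T (e.symm (x, y)) = T D₀ := by
      apply hT
      intro v hv
      have h : ¬ decide (v ∈ X) = true := by simpa using hv
      rw [hD₀ v h]
      simp [he, MeasurableEquiv.piEquivPiSubtypeProd, hv]
    simp only [Set.mem_pi, Set.mem_univ, true_implies]
    intro v j
    have hv : v.1 ∈ X := by simpa using v.2
    have := hx v.1 hv j
    rw [hTx] at this
    have hxv : e.symm (x, y) v.1 = x v := by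
      simp [he, MeasurableEquiv.piEquivPiSubtypeProd, hv]
    rwa [hxv] at this
  refine (measure_mono hsub).trans ?_
  have hcard : Fintype.card {v // decide (v ∈ X) = true} = X.card :=
    Fintype.card_of_subtype X fun v => by simp
  rw [Measure.pi_pi]
  simp only [Measure.pi_pi, uniformOn_univ_finset, Finset.prod_const, Finset.card_univ,
    Fintype.card_fin, hcard, ← pow_mul]
  gcongr
  exact ht D₀

end ReqLaw

/-! ### Random subsets -/

section RandomFinset

variable {Ω α : Type*} [MeasurableSpace Ω] [DiscreteMeasurableSpace Ω] [DecidableEq α]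
  {μ : Measure Ω} {F : Ω → Finset α} {V : Finset α}

/-- If all elements of a set `X` belong to a random subset of `V` with probability at most `q^|X|`,
then the moment generating function of the size of this subset is bounded by the one of a
binomial distribution. -/
theorem lintegral_one_add_pow_card_le (hF : ∀ ω, F ω ⊆ V) {q : ℝ≥0∞}
    (hq : ∀ X ⊆ V, μ {ω | X ⊆ F ω} ≤ q ^ X.card) (y : ℝ≥0∞) :
    ∫⁻ ω, (1 + y) ^ (F ω).card ∂μ ≤ (1 + y * q) ^ V.card := by
  have hexp : ∀ (A : Finset α) (z : ℝ≥0∞), (1 + z) ^ A.card = ∑ X ∈ A.powerset, z ^ X.card := by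
    intro A z
    have := Finset.prod_one_add (f := fun _ : α => z) A
    simpa [Finset.prod_const] using this
  have h1 : ∀ ω, (1 + y) ^ (F ω).card =
      ∑ X ∈ V.powerset, Set.indicator {ω | X ⊆ F ω} (fun _ => y ^ X.card) ω := by
    intro ω
    rw [hexp]
    simp only [Set.indicator_apply, Set.mem_ofPred_eq]
    rw [← Finset.sum_filter]
    congr 1
    ext X
    simp only [Finset.mem_powerset, Finset.mem_filter]
    exact ⟨fun h => ⟨h.trans (hF ω), h⟩, fun h => h.2⟩
  simp only [h1]
  rw [lintegral_finsetSum _ fun X _ => Measurable.of_discrete, hexp]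
  refine Finset.sum_le_sum fun X hX => ?_
  rw [lintegral_indicator (MeasurableSet.of_discrete), setLIntegral_const, mul_pow]
  gcongr
  exact hq X (Finset.mem_powerset.1 hX)

end RandomFinset

/-- The union bound over all sets of size `x`. -/
theorem measure_le_card_le {Ω α : Type*} [MeasurableSpace Ω] {μ : Measure Ω}
    {F : Ω → Finset α} {V : Finset α} (hF : ∀ ω, F ω ⊆ V) (x : ℕ) {p : ℝ≥0∞}
    (hp : ∀ X ⊆ V, X.card = x → μ {ω | X ⊆ F ω} ≤ p) :
    μ {ω | x ≤ (F ω).card} ≤ V.card.choose x * p := by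
  have hsub : {ω | x ≤ (F ω).card} ⊆ ⋃ X ∈ V.powersetCard x, {ω | X ⊆ F ω} := by
    intro ω hω
    obtain ⟨X, hX, hc⟩ := Finset.exists_subset_card_eq (show x ≤ (F ω).card from hω)
    simp only [Set.mem_iUnion]
    exact ⟨X, Finset.mem_powersetCard.2 ⟨hX.trans (hF ω), hc⟩, hX⟩
  refine (measure_mono hsub).trans ((measure_biUnion_finset_le _ _).trans ?_)
  refine (Finset.sum_le_card_nsmul _ _ p fun X hX => ?_).trans ?_
  · rw [Finset.mem_powersetCard] at hX
    exact hp X hX.1 hX.2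
  · rw [Finset.card_powersetCard, nsmul_eq_mul]


/-! ### Exposing the rounds one after another -/

section Law

variable {n : ℕ}

/-- A function of finitely many rounds is measurable, as the choices of a round form a finite
discrete space. -/
theorem measurable_of_adapted {β : Type*} [MeasurableSpace β] (f : Sample n → β) (i : ℕ)
    (hf : ∀ ω ω', (∀ j < i, ω j = ω' j) → f ω = f ω') : Measurable f := by
  rcases isEmpty_or_nonempty (Sample n) with he | ⟨⟨ω₀⟩⟩
  · exact fun s _ => by rw [Set.eq_empty_of_isEmpty (f ⁻¹' s)]; exact MeasurableSet.empty
  · let ext : ((j : Fin i) → Draws n j) → Sample n := fun h j =>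
      if hj : j < i then h ⟨j, hj⟩ else ω₀ j
    have h : f = (fun h => f (ext h)) ∘ fun ω (j : Fin i) => ω j := by
      funext ω
      exact hf _ _ fun j hj => by simp [ext, hj]
    rw [h]
    exact Measurable.of_discrete.comp (measurable_pi_lambda _ fun j => measurable_pi_apply _)

variable [NeZero n]

/-- Drawing the requests of round `i` anew does not change the law. Together with `adapted`, this
plays the role of conditioning on the other rounds. -/
theorem lintegral_law_eq_lintegral_update (i : ℕ) {F : Sample n → ℝ≥0∞} (hF : Measurable F) :
    ∫⁻ ω, F ω ∂law n =
      ∫⁻ ω, ∫⁻ D, F (Function.update ω i D) ∂(reqLaw n (numReq n i)) ∂law n := by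
  have hmeas : Measurable fun p : Sample n × Draws n i => Function.update p.1 i p.2 :=
    measurable_update'
  have hmap : ((law n).prod (reqLaw n (numReq n i))).map
      (fun p : Sample n × Draws n i => Function.update p.1 i p.2) = law n := by
    refine Measure.eq_infinitePi _ fun s t ht => ?_
    have hpre : (fun p : Sample n × Draws n i => Function.update p.1 i p.2) ⁻¹' Set.pi s t =
        (Set.pi (s.erase i : Finset ℕ) t) ×ˢ (if i ∈ s then t i else Set.univ) := by
      ext p
      simp only [Set.mem_preimage, Set.mem_pi, Finset.mem_coe, Set.mem_prod, Finset.mem_erase]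
      constructor
      · intro h
        refine ⟨fun j hj => ?_, ?_⟩
        · have := h j hj.2
          rwa [Function.update_of_ne hj.1] at this
        · split_ifs with hi
          · simpa using h i hi
          · trivial
      · rintro ⟨h1, h2⟩ j hj
        by_cases hji : j = i
        · subst hji
          rw [if_pos hj] at h2
          simpa using h2
        · rw [Function.update_of_ne hji]
          exact h1 j ⟨hji, hj⟩
    rw [Measure.map_apply hmeas (MeasurableSet.pi s.countable_toSet fun j _ => ht j), hpre,
      Measure.prod_prod, law, Measure.infinitePi_pi _ fun j _ => ht j]
    split_ifs with hi
    · rw [mul_comm, ← Finset.mul_prod_erase s _ hi]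
      rfl
    · rw [measure_univ, mul_one, Finset.erase_eq_of_notMem hi]
  conv_lhs => rw [← hmap]
  rw [lintegral_map hF hmeas]
  exact lintegral_prod _ (hF.comp hmeas).aemeasurable

theorem lintegral_law_le (i : ℕ) {F G : Sample n → ℝ≥0∞} (hF : Measurable F)
    (h : ∀ ω, ∫⁻ D, F (Function.update ω i D) ∂(reqLaw n (numReq n i)) ≤ G ω) :
    ∫⁻ ω, F ω ∂law n ≤ ∫⁻ ω, G ω ∂law n :=
  (lintegral_law_eq_lintegral_update i hF).trans_le (lintegral_mono h)

end Law

/-! ### One round -/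

/-- The balls that are not yet placed. -/
def unplaced {n : ℕ} (P : Placement n) : Finset (Fin n) := Finset.univ.filter fun v => P v = none

/-- The bins holding (at least) two balls. -/
def fullBins {n : ℕ} (P : Placement n) : Finset (Fin n) := Finset.univ.filter fun w => ¬ load P w < 2

@[simp] theorem mem_unplaced {n : ℕ} {P : Placement n} {v : Fin n} :
    v ∈ unplaced P ↔ P v = none := by
  simp [unplaced]

theorem card_unplaced_le {n : ℕ} (P : Placement n) : (unplaced P).card ≤ n :=
  (Finset.card_le_univ _).trans_eq (Fintype.card_fin n)

/-- At most half of the bins are full, as each full bin accounts for two placed balls. -/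
theorem two_mul_card_fullBins_add_card_unplaced_le {n : ℕ} (P : Placement n) :
    2 * (fullBins P).card + (unplaced P).card ≤ n := by
  have h1 : ∑ w, load P w + (unplaced P).card = n := by
    have h := Finset.card_eq_sum_card_fiberwise (f := P) (s := Finset.univ)
      (t := (Finset.univ : Finset (Option (Fin n)))) (by simp)
    rw [Fintype.sum_option, Finset.card_univ, Fintype.card_fin] at h
    rw [add_comm]
    exact h.symm
  have h2 : 2 * (fullBins P).card ≤ ∑ w, load P w := by
    calc 2 * (fullBins P).card = ∑ w ∈ fullBins P, 2 := by simp [mul_comm]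
      _ ≤ ∑ w ∈ fullBins P, load P w := by
        refine Finset.sum_le_sum fun w hw => ?_
        simp only [fullBins, Finset.mem_filter, Finset.mem_univ, true_and] at hw
        omega
      _ ≤ ∑ w, load P w := Finset.sum_le_sum_of_subset (Finset.subset_univ _)
  omega

theorem natCast_div_le_ofReal {a n : ℕ} (hn : n ≠ 0) {r : ℝ} (h : (a : ℝ) ≤ r * n) :
    (a : ℝ≥0∞) / n ≤ ENNReal.ofReal r := by
  have hn' : (0 : ℝ) < n := by exact_mod_cast Nat.pos_of_ne_zero hn
  rw [← ENNReal.ofReal_natCast, ← ENNReal.ofReal_natCast, ← ENNReal.ofReal_div_of_pos hn']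
  exact ENNReal.ofReal_le_ofReal ((div_le_iff₀ hn').2 h)

namespace IsExecution

variable {n : ℕ} {P : Sample n → ℕ → Placement n} (hP : IsExecution P)
include hP

theorem eq_none_of_succ {ω : Sample n} {i : ℕ} {v : Fin n} (h : P ω (i + 1) v = none) :
    P ω i v = none := by
  by_contra h0
  exact h0 ((hP.placed_succ ω i v h0).symm.trans h)

theorem eq_none_of_le {ω : Sample n} {i j : ℕ} (hij : i ≤ j) {v : Fin n} (h : P ω j v = none) :
    P ω i v = none := by
  induction j, hij using Nat.le_induction with
  | base => exact h
  | succ j _ ih => exact ih (hP.eq_none_of_succ h)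

theorem unplaced_anti (ω : Sample n) {i j : ℕ} (hij : i ≤ j) :
    unplaced (P ω j) ⊆ unplaced (P ω i) := fun v hv => by
  rw [mem_unplaced] at hv ⊢
  exact hP.eq_none_of_le hij hv

theorem update_eq (ω : Sample n) (i : ℕ) (D : Draws n i) {j : ℕ} (hj : j ≤ i) :
    P (Function.update ω i D) j = P ω j :=
  hP.adapted _ _ _ fun _ hk => Function.update_of_ne (by omega) _ _

theorem measurable_comp {β : Type*} [MeasurableSpace β] (i : ℕ) (f : Placement n → β) :
    Measurable fun ω => f (P ω i) :=
  measurable_of_adapted _ i fun ω ω' h => by rw [hP.adapted i ω ω' h]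

theorem unplaced_update_subset (ω : Sample n) (i : ℕ) (D : Draws n i) :
    unplaced (P (Function.update ω i D) (i + 1)) ⊆ unplaced (P ω i) := by
  rw [← hP.update_eq ω i D le_rfl]
  exact hP.unplaced_anti _ (Nat.le_succ i)

variable [NeZero n]

/-- If all balls of `X` fail, then all their requests go to bins that are full or requested by
other unplaced balls: every other requested bin permits some ball, which is then placed. -/
theorem reqLaw_subset_unplaced_le (ω : Sample n) (i : ℕ) {X : Finset (Fin n)}
    (hX : X ⊆ unplaced (P ω i)) {r : ℝ}
    (hr : (((fullBins (P ω i)).card + numReq n i * ((unplaced (P ω i)).card - X.card) : ℕ) : ℝ) ≤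
      r * n) :
    reqLaw n (numReq n i) {D | X ⊆ unplaced (P (Function.update ω i D) (i + 1))} ≤
      ENNReal.ofReal r ^ (numReq n i * X.card) := by
  let T : (Fin n → Fin (numReq n i) → Fin n) → Finset (Fin n) := fun D =>
    fullBins (P ω i) ∪ (unplaced (P ω i) \ X).biUnion fun v => Finset.univ.image (D v)
  have hT : ∀ D D', (∀ v, v ∉ X → D v = D' v) → T D = T D' := by
    intro D D' h
    simp only [T]
    congr 1
    refine Finset.biUnion_congr rfl fun v hv => ?_
    rw [h v (Finset.mem_sdiff.1 hv).2]
  have hcard : ∀ D, (T D).card ≤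
      (fullBins (P ω i)).card + numReq n i * ((unplaced (P ω i)).card - X.card) := by
    intro D
    refine (Finset.card_union_le _ _).trans (Nat.add_le_add_left ?_ _)
    rw [← Finset.card_sdiff_of_subset hX, mul_comm]
    refine Finset.card_biUnion_le_card_mul _ _ _ fun v _ => ?_
    exact Finset.card_image_le.trans (by simp)
  have h := reqLaw_forall_mem_le X T hT (t := (((fullBins (P ω i)).card +
    numReq n i * ((unplaced (P ω i)).card - X.card) : ℕ) : ℝ≥0∞)) fun D => by
      exact_mod_cast hcard D
  refine (measure_mono ?_).trans (h.trans ?_)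
  · intro D hD v hv j
    by_cases hw : load (P ω i) (D v j) < 2
    · obtain ⟨v', h1, h2, j', h3⟩ := hP.competitor (Function.update ω i D) i v j
        (by simpa using hD hv) (by rwa [hP.update_eq ω i D le_rfl, Function.update_self])
      rw [hP.update_eq ω i D le_rfl] at h1
      rw [Function.update_self] at h3
      refine Finset.mem_union_right _ (Finset.mem_biUnion.2 ⟨v', ?_, ?_⟩)
      · rw [Finset.mem_sdiff, mem_unplaced]
        exact ⟨h1, fun hv' => h2 (by simpa using hD hv')⟩
      · exact Finset.mem_image.2 ⟨j', Finset.mem_univ _, h3⟩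
    · exact Finset.mem_union_left _ (by simpa [fullBins] using hw)
  · gcongr
    exact natCast_div_le_ofReal (NeZero.ne n) hr

/-- If there are at most `n / 4` requests, then at most `n / 2` bins are full and at most `n / 4`
bins are requested by others. -/
theorem reqLaw_subset_unplaced_le_of_four_mul_le (ω : Sample n) (i : ℕ)
    (hM : 4 * ((unplaced (P ω i)).card * numReq n i) ≤ n) {X : Finset (Fin n)}
    (hX : X ⊆ unplaced (P ω i)) :
    reqLaw n (numReq n i) {D | X ⊆ unplaced (P (Function.update ω i D) (i + 1))} ≤
      ENNReal.ofReal (3 / 4) ^ (numReq n i * X.card) := by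
  refine hP.reqLaw_subset_unplaced_le ω i hX ?_
  have h1 := two_mul_card_fullBins_add_card_unplaced_le (P ω i)
  have h2 : numReq n i * ((unplaced (P ω i)).card - X.card) ≤
      (unplaced (P ω i)).card * numReq n i := by
    rw [mul_comm]; exact Nat.mul_le_mul_right _ (Nat.sub_le _ _)
  have h3 : 4 * ((fullBins (P ω i)).card +
      numReq n i * ((unplaced (P ω i)).card - X.card)) ≤ 3 * n := by omega
  have h4 : (4 : ℝ) * (((fullBins (P ω i)).card +
      numReq n i * ((unplaced (P ω i)).card - X.card) : ℕ) : ℝ) ≤ 3 * n := by exact_mod_cast h3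
  linarith

theorem reqLaw_eq_none_le (ω : Sample n) (i : ℕ)
    (hM : 4 * ((unplaced (P ω i)).card * numReq n i) ≤ n) {v : Fin n} (hv : P ω i v = none) :
    reqLaw n (numReq n i) {D | P (Function.update ω i D) (i + 1) v = none} ≤
      ENNReal.ofReal (3 / 4) ^ numReq n i := by
  have h := hP.reqLaw_subset_unplaced_le_of_four_mul_le ω i hM (X := {v}) (by simpa using hv)
  simpa using h

/-- If no ball is placed, then all requests go to full bins. -/
theorem reqLaw_unplaced_eq_le (ω : Sample n) (i : ℕ) (hK : numReq n i ≠ 0)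
    (hu : (unplaced (P ω i)).Nonempty) :
    reqLaw n (numReq n i) {D | unplaced (P ω i) ⊆ unplaced (P (Function.update ω i D) (i + 1))} ≤
      2⁻¹ := by
  refine (hP.reqLaw_subset_unplaced_le ω i (r := 1 / 2) subset_rfl ?_).trans ?_
  · have h1 := two_mul_card_fullBins_add_card_unplaced_le (P ω i)
    rw [Nat.sub_self, mul_zero, add_zero]
    have h2 : (2 : ℝ) * (fullBins (P ω i)).card ≤ n := by
      exact_mod_cast (Nat.le_add_right _ _).trans h1
    linarith
  · have h : ENNReal.ofReal (1 / 2) = 2⁻¹ := by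
      rw [one_div, ENNReal.ofReal_inv_of_pos (by norm_num)]; simp
    rw [h]
    exact pow_le_of_le_one (by simp) (by simp) (Nat.mul_ne_zero hK hu.card_pos.ne')

/-- With at most `n / 4` requests, the number of balls left is dominated, in terms of moment
generating functions, by independent failures with probability `(3/4)^⌊k⌋`. -/
theorem lintegral_one_add_pow_unplaced_le (ω : Sample n) (i : ℕ)
    (hM : 4 * ((unplaced (P ω i)).card * numReq n i) ≤ n) (y : ℝ≥0∞) :
    ∫⁻ D, (1 + y) ^ (unplaced (P (Function.update ω i D) (i + 1))).card ∂reqLaw n (numReq n i) ≤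
      (1 + y * ENNReal.ofReal (3 / 4) ^ numReq n i) ^ (unplaced (P ω i)).card := by
  refine lintegral_one_add_pow_card_le (fun D => hP.unplaced_update_subset ω i D)
    (fun X hX => ?_) y
  rw [← pow_mul]
  exact hP.reqLaw_subset_unplaced_le_of_four_mul_le ω i hM hX

end IsExecution

/-! ### Requests at a bin -/

section RequestsAt

variable {n : ℕ} [NeZero n] {K : ℕ}

theorem lintegral_one_add_pow_card_requests_le (U : Finset (Fin n)) (w : Fin n) (y : ℝ≥0∞) :
    ∫⁻ D, (1 + y) ^ (Finset.univ.filter fun r : Fin n × Fin K => r.1 ∈ U ∧ D r.1 r.2 = w).card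
      ∂reqLaw n K ≤ (1 + y * (n : ℝ≥0∞)⁻¹) ^ (U.card * K) := by
  have h := lintegral_one_add_pow_card_le (μ := reqLaw n K)
    (F := fun D => Finset.univ.filter fun r : Fin n × Fin K => r.1 ∈ U ∧ D r.1 r.2 = w)
    (V := U ×ˢ Finset.univ) (q := (n : ℝ≥0∞)⁻¹) (fun D r hr => by
      simp only [Finset.mem_filter, Finset.mem_univ, true_and] at hr
      simpa using hr.1) (fun X _ => ?_) y
  · simpa [Finset.card_product] using h
  · rw [← reqLaw_forall_eq X w]
    refine measure_mono fun D hD r hr => ?_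
    have := hD hr
    simp only [Finset.mem_filter, Finset.mem_univ, true_and] at this
    exact this.2

theorem lintegral_card_requests (U : Finset (Fin n)) (w : Fin n) :
    ∫⁻ D, ((Finset.univ.filter fun r : Fin n × Fin K => r.1 ∈ U ∧ D r.1 r.2 = w).card : ℝ≥0∞)
      ∂reqLaw n K = (U.card * K : ℕ) * (n : ℝ≥0∞)⁻¹ := by
  have h : ∀ D : Fin n → Fin K → Fin n,
      ((Finset.univ.filter fun r : Fin n × Fin K => r.1 ∈ U ∧ D r.1 r.2 = w).card : ℝ≥0∞) =
      ∑ r ∈ U ×ˢ (Finset.univ : Finset (Fin K)),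
        Set.indicator {D : Fin n → Fin K → Fin n | D r.1 r.2 = w} 1 D := by
    intro D
    simp only [Set.indicator_apply, Set.mem_ofPred_eq, Pi.one_apply]
    rw [Finset.sum_boole]
    congr 2
    ext r
    simp
  simp only [h]
  rw [lintegral_finsetSum _ fun X _ => Measurable.of_discrete]
  have h1 : ∀ r : Fin n × Fin K, ∫⁻ D, Set.indicator
      {D : Fin n → Fin K → Fin n | D r.1 r.2 = w} 1 D ∂reqLaw n K = (n : ℝ≥0∞)⁻¹ := by
    intro r
    rw [lintegral_indicator_one MeasurableSet.of_discrete]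
    have := reqLaw_forall_eq (K := K) {r} w
    simpa using this
  simp only [h1, Finset.sum_const, Finset.card_product, Finset.card_univ, Fintype.card_fin,
    nsmul_eq_mul]

end RequestsAt

/-! ### The number of requests per round -/

theorem eleven_tenths_le_exp : (11 / 10 : ℝ) ≤ Real.exp (1 / 10) := by
  have := Real.add_one_le_exp (1 / 10 : ℝ)
  linarith

theorem three_quarters_pow_mul_exp_le (K : ℕ) :
    (3 / 4) ^ K * Real.exp ((K : ℝ) / 10) ≤ (83 / 100) ^ K := by
  have hexp : Real.exp (1 / 10) ≤ 83 / 75 := by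
    refine le_of_pow_le_pow_left₀ (n := 10) (by norm_num) (by norm_num) ?_
    rw [← Real.exp_nat_mul]
    have h1 := Real.exp_one_lt_d9
    norm_num at h1 ⊢
    linarith
  calc (3 / 4) ^ K * Real.exp ((K : ℝ) / 10) = (3 / 4 * Real.exp (1 / 10)) ^ K := by
        rw [mul_pow, ← Real.exp_nat_mul]; congr 2; ring
    _ ≤ (83 / 100) ^ K := by
        gcongr
        linarith

theorem exp_six_tenths_lt : Real.exp (6 / 10) < 2 := by
  refine lt_of_pow_lt_pow_left₀ 10 (by norm_num) ?_
  rw [← Real.exp_nat_mul]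
  have h1 := Real.exp_one_lt_d9
  have h2 : Real.exp (((10 : ℕ) : ℝ) * (6 / 10)) = Real.exp 1 ^ 6 := by
    rw [← Real.exp_nat_mul]; norm_num
  rw [h2]
  calc Real.exp 1 ^ 6 < 2.7182818286 ^ 6 := by gcongr
    _ < 2 ^ 10 := by norm_num

theorem two_le_exp_seven_tenths : 2 ≤ Real.exp (7 / 10) := by
  refine le_of_pow_le_pow_left₀ (n := 10) (by norm_num) (Real.exp_pos _).le ?_
  rw [← Real.exp_nat_mul]
  have h1 := Real.exp_one_gt_d9
  have h2 : Real.exp (((10 : ℕ) : ℝ) * (7 / 10)) = Real.exp 1 ^ 7 := by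
    rw [← Real.exp_nat_mul]; norm_num
  rw [h2]
  calc (2 : ℝ) ^ 10 ≤ 2.7182818283 ^ 7 := by norm_num
    _ ≤ Real.exp 1 ^ 7 := by gcongr

theorem exp_seven_tenths_le : Real.exp (7 / 10) ≤ 25 / 12 := by
  refine le_of_pow_le_pow_left₀ (n := 10) (by norm_num) (by norm_num) ?_
  rw [← Real.exp_nat_mul]
  have h1 := Real.exp_one_lt_d9
  have h2 : Real.exp (((10 : ℕ) : ℝ) * (7 / 10)) = Real.exp 1 ^ 7 := by
    rw [← Real.exp_nat_mul]; norm_num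
  rw [h2]
  calc Real.exp 1 ^ 7 ≤ 2.7182818286 ^ 7 := by gcongr
    _ ≤ (25 / 12) ^ 10 := by norm_num

theorem logb_two_natCast_le (n : ℕ) : Real.logb 2 n ≤ n := by
  rcases Nat.eq_zero_or_pos n with rfl | hn
  · simp
  · rw [Real.logb_le_iff_le_rpow (by norm_num) (by exact_mod_cast hn), Real.rpow_natCast]
    exact_mod_cast (Nat.lt_two_pow_self (n := n)).le

section KParam

variable {n : ℕ}

theorem kParam_succ_le (i : ℕ) :
    kParam n (i + 1) ≤ kParam n i * Real.exp ((numReq n i : ℝ) / 10) := min_le_left _ _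

theorem kParam_succ (i : ℕ) : kParam n (i + 1) =
    min (kParam n i * Real.exp ((numReq n i : ℝ) / 10)) (Real.logb 2 n) := rfl

variable (hL : 4 ≤ Real.logb 2 n)
include hL

theorem kParam_le_logb (i : ℕ) : kParam n i ≤ Real.logb 2 n := by
  cases i with
  | zero => simp only [kParam]; linarith
  | succ i => exact min_le_right _ _

theorem one_le_kParam (i : ℕ) : 1 ≤ kParam n i := by
  induction i with
  | zero => simp [kParam]
  | succ i ih =>
    rw [kParam_succ]
    refine le_min ?_ (by linarith)
    have : 1 ≤ Real.exp ((numReq n i : ℝ) / 10) := Real.one_le_exp (by positivity)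
    nlinarith

theorem one_le_numReq (i : ℕ) : 1 ≤ numReq n i := by
  rw [numReq, Nat.one_le_floor_iff]
  exact one_le_kParam hL i

theorem numReq_le_kParam (i : ℕ) : (numReq n i : ℝ) ≤ kParam n i :=
  Nat.floor_le (by linarith [one_le_kParam hL i])

theorem numReq_le_logb (i : ℕ) : (numReq n i : ℝ) ≤ Real.logb 2 n :=
  (numReq_le_kParam hL i).trans (kParam_le_logb hL i)

theorem exp_one_tenth_le_exp_numReq (i : ℕ) :
    Real.exp (1 / 10) ≤ Real.exp ((numReq n i : ℝ) / 10) := by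
  have : (1 : ℝ) ≤ numReq n i := by exact_mod_cast one_le_numReq hL i
  gcongr

theorem min_le_kParam_succ (i : ℕ) :
    min (11 / 10 * kParam n i) (Real.logb 2 n) ≤ kParam n (i + 1) := by
  rw [kParam_succ]
  refine min_le_min_right _ ?_
  rw [mul_comm]
  have := one_le_kParam hL i
  gcongr
  exact eleven_tenths_le_exp.trans (exp_one_tenth_le_exp_numReq hL i)

theorem kParam_monotone : Monotone (kParam n) := by
  refine monotone_nat_of_le_succ fun i => le_trans ?_ (min_le_kParam_succ hL i)
  have := one_le_kParam hL i
  exact le_min (by linarith) (kParam_le_logb hL i)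

theorem numReq_monotone : Monotone (numReq n) := fun _ _ h =>
  Nat.floor_mono (kParam_monotone hL h)

theorem kParam_eq_exp {i : ℕ} (hi : i ≤ 7) : kParam n i = Real.exp (i / 10) := by
  induction i with
  | zero => simp [kParam]
  | succ i ih =>
    have ih := ih (by omega)
    have hi' : (i : ℝ) ≤ 6 := by exact_mod_cast Nat.le_of_succ_le_succ hi
    have hk : numReq n i = 1 := by
      rw [numReq, Nat.floor_eq_iff (by linarith [one_le_kParam hL i])]
      refine ⟨by exact_mod_cast one_le_kParam hL i, ?_⟩
      rw [ih]
      calc Real.exp (i / 10) ≤ Real.exp (6 / 10) := by gcongr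
        _ < 2 := exp_six_tenths_lt
        _ = ((1 : ℕ) : ℝ) + 1 := by norm_num
    rw [kParam_succ, hk, ih, ← Real.exp_add]
    have h : (i : ℝ) / 10 + ((1 : ℕ) : ℝ) / 10 = ((i + 1 : ℕ) : ℝ) / 10 := by push_cast; ring
    rw [h, min_eq_left]
    calc Real.exp (((i + 1 : ℕ) : ℝ) / 10) ≤ Real.exp (7 / 10) := by
          have : ((i + 1 : ℕ) : ℝ) ≤ 7 := by exact_mod_cast hi
          gcongr
      _ ≤ 25 / 12 := exp_seven_tenths_le
      _ ≤ _ := by linarith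

theorem kParam_lt_two {i : ℕ} (hi : i ≤ 6) : kParam n i < 2 := by
  rw [kParam_eq_exp hL (by omega)]
  have hi' : (i : ℝ) ≤ 6 := by exact_mod_cast hi
  calc Real.exp (i / 10) ≤ Real.exp (6 / 10) := by gcongr
    _ < 2 := exp_six_tenths_lt

theorem numReq_eq_one {i : ℕ} (hi : i ≤ 6) : numReq n i = 1 := by
  rw [numReq, Nat.floor_eq_iff (by linarith [one_le_kParam hL i])]
  exact ⟨by exact_mod_cast one_le_kParam hL i, by norm_num; linarith [kParam_lt_two hL hi]⟩

theorem kParam_seven_le : kParam n 7 ≤ 25 / 12 := by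
  rw [kParam_eq_exp hL le_rfl]
  exact_mod_cast exp_seven_tenths_le

theorem two_le_numReq {i : ℕ} (hi : 7 ≤ i) : 2 ≤ numReq n i := by
  refine le_trans ?_ (numReq_monotone hL hi)
  rw [numReq, kParam_eq_exp hL le_rfl]
  exact Nat.le_floor (by exact_mod_cast two_le_exp_seven_tenths)

theorem kParam_eq_logb_of_le {i j : ℕ} (hij : i ≤ j) (h : kParam n i = Real.logb 2 n) :
    kParam n j = Real.logb 2 n :=
  le_antisymm (kParam_le_logb hL j) (h ▸ kParam_monotone hL hij)

theorem min_pow_le_kParam (i : ℕ) : min ((11 / 10) ^ i) (Real.logb 2 n) ≤ kParam n i := by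
  induction i with
  | zero => simp [kParam]
  | succ i ih =>
    refine le_trans (le_min ?_ (min_le_right _ _)) (min_le_kParam_succ hL i)
    rcases min_le_iff.1 ih with h | h
    · refine (min_le_left _ _).trans ?_
      rw [pow_succ']
      gcongr
    · refine (min_le_right _ _).trans ?_
      linarith

/-- Once it exceeds ten times a tower, the parameter grows at least like ten times the tower. -/
theorem min_tower_le_kParam (t : ℕ) :
    min (10 * (tower t : ℝ)) (Real.logb 2 n) ≤ kParam n (25 + t) := by
  induction t with
  | zero =>
    refine le_trans (min_le_min_right _ ?_) (min_pow_le_kParam hL 25)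
    norm_num [tower]
  | succ t ih =>
    rcases min_le_iff.1 ih with h | h
    · have hfl : 10 * tower t ≤ numReq n (25 + t) := Nat.le_floor (by exact_mod_cast h)
      have ht : (1 : ℝ) ≤ tower t := by exact_mod_cast (Nat.succ_le_of_lt (lt_tower t)).trans' (by omega)
      rw [← add_assoc, kParam_succ]
      refine min_le_min_right _ ?_
      have hexp : (tower (t + 1) : ℝ) ≤ Real.exp ((numReq n (25 + t) : ℝ) / 10) := by
        calc (tower (t + 1) : ℝ) = 2 ^ tower t := by simp [tower]
          _ ≤ Real.exp 1 ^ tower t := by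
            have := Real.exp_one_gt_d9
            gcongr
            linarith
          _ = Real.exp (tower t) := by rw [← Real.exp_nat_mul]; simp
          _ ≤ _ := by
            have : (10 * tower t : ℝ) ≤ numReq n (25 + t) := by exact_mod_cast hfl
            gcongr
            linarith
      have h10 : 10 ≤ kParam n (25 + t) := by linarith
      gcongr
    · exact (min_le_right _ _).trans (h.trans (kParam_monotone hL (by omega)))

theorem kParam_logStar : kParam n (25 + logStar n) = Real.logb 2 n := by
  refine le_antisymm (kParam_le_logb hL _) (le_trans (le_min ?_ le_rfl) (min_tower_le_kParam hL _))
  have h1 : (n : ℝ) ≤ tower (logStar n) := by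
    exact_mod_cast Nat.find_spec (p := fun t => n ≤ tower t) _
  have h2 := logb_two_natCast_le n
  linarith

/-- The parameter reaches its final value `log n` within `log* n + O(1)` rounds. As it grows at
least geometrically before, its sum over these rounds is `O(log n)`. -/
theorem exists_saturation : ∃ m, 7 ≤ m ∧ m ≤ logStar n + 25 ∧
    (∀ j, m ≤ j → kParam n j = Real.logb 2 n) ∧
    ∑ i ∈ Finset.range m, kParam n i ≤ 11 * Real.logb 2 n := by
  have hex : ∃ m, kParam n m = Real.logb 2 n := ⟨_, kParam_logStar hL⟩
  have hspec := Nat.find_spec hex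
  have hmin : ∀ i < Nat.find hex, kParam n i < Real.logb 2 n := fun i hi =>
    lt_of_le_of_ne (kParam_le_logb hL i) (Nat.find_min hex hi)
  refine ⟨Nat.find hex, ?_, ?_, fun j hj => kParam_eq_logb_of_le hL hj hspec, ?_⟩
  · by_contra h
    have := kParam_lt_two hL (show Nat.find hex ≤ 6 by omega)
    rw [hspec] at this
    linarith
  · rw [add_comm]; exact Nat.find_min' hex (kParam_logStar hL)
  · have hsum : ∀ i < Nat.find hex, ∑ j ∈ Finset.range i, kParam n j ≤ 10 * kParam n i := by
      intro i
      induction i with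
      | zero => intro _; simp [kParam]
      | succ i ih =>
        intro hi
        rw [Finset.sum_range_succ]
        have h1 := ih (by omega)
        have h2 := min_le_kParam_succ hL i
        rcases min_le_iff.1 h2 with h | h
        · linarith
        · exact absurd (hmin _ hi) (not_lt.2 h)
    obtain ⟨m, hm⟩ : ∃ m, Nat.find hex = m + 1 := by
      refine Nat.exists_eq_succ_of_ne_zero fun h0 => ?_
      rw [h0] at hspec
      simp only [kParam] at hspec
      linarith
    rw [hm, Finset.sum_range_succ]
    have h1 := hsum m (by omega)
    have h2 := kParam_le_logb hL m
    linarith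

end KParam

/-! ### The number of unplaced balls -/

/-- Chernoff's bound for a random natural number. -/
theorem measure_lt_natCast_le {Ω : Type*} [MeasurableSpace Ω] {μ : Measure Ω} {f : Ω → ℕ}
    (hf : Measurable f) {a M : ℝ} (ha : 1 ≤ a)
    (h : ∫⁻ ω, ENNReal.ofReal a ^ f ω ∂μ ≤ ENNReal.ofReal M) (x : ℝ) :
    μ {ω | x < f ω} ≤ ENNReal.ofReal (M / a ^ x) := by
  have ha0 : 0 < a := by linarith
  have hax : 0 < a ^ x := Real.rpow_pos_of_pos ha0 x
  have hmeas : Measurable fun ω => ENNReal.ofReal a ^ f ω :=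
    (measurable_of_countable fun k : ℕ => ENNReal.ofReal a ^ k).comp hf
  have hm := mul_meas_ge_le_lintegral (μ := μ) hmeas (ENNReal.ofReal (a ^ x))
  have hsub : {ω | x < f ω} ⊆ {ω | ENNReal.ofReal (a ^ x) ≤ ENNReal.ofReal a ^ f ω} := by
    intro ω hω
    rw [Set.mem_ofPred_eq, ← ENNReal.ofReal_pow ha0.le, ← Real.rpow_natCast]
    exact ENNReal.ofReal_le_ofReal (Real.rpow_le_rpow_of_exponent_le ha (le_of_lt hω))
  rw [ENNReal.ofReal_div_of_pos hax, ENNReal.le_div_iff_mul_le (Or.inl (by simpa using hax))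
    (Or.inl ENNReal.ofReal_ne_top), mul_comm]
  exact (mul_le_mul_right (measure_mono hsub) _).trans (hm.trans h)

theorem choose_mul_pow_le {z : ℝ} (hz : 0 ≤ z) (u x : ℕ) :
    (u.choose x : ℝ) * z ^ x ≤ (1 + z) ^ u := by
  rcases le_or_gt x u with h | h
  · rw [add_comm, add_pow]
    refine le_trans (le_of_eq ?_) (Finset.single_le_sum (f := fun m =>
      z ^ m * 1 ^ (u - m) * (u.choose m : ℝ)) (fun m _ => by positivity)
      (Finset.mem_range.2 (Nat.lt_succ_of_le h)))
    simp [mul_comm]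
  · rw [Nat.choose_eq_zero_of_lt h]
    simp only [Nat.cast_zero, zero_mul]
    positivity

namespace IsExecution

variable {n : ℕ} {P : Sample n → ℕ → Placement n} (hP : IsExecution P) [NeZero n]
include hP

/-- A round with one request per ball: if at most `A` percent of the balls are left, then at most
`B` percent of the balls are left afterwards, up to an exponentially small probability. The
parameter `z` is the one for which `(1 + z)^u / z^x` is the entropy bound for the number of sets
of `x = B n / 100` out of `u = A n / 100` balls. -/
theorem reqLaw_lt_unplaced_le_of_numReq_eq_one (ω : Sample n) (i : ℕ) (hK : numReq n i = 1)
    {A B : ℕ} (hu : 100 * (unplaced (P ω i)).card ≤ A * n) {z r : ℝ} (hz : 0 < z)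
    (hr : (100 + A) / 200 - B / 100 ≤ r) (hr0 : 0 ≤ r) (hrz : r ≤ z)
    (hnum : (1 + z) ^ A * (r / z) ^ B ≤ 1 / 2) :
    reqLaw n (numReq n i)
      {D | B * n < 100 * (unplaced (P (Function.update ω i D) (i + 1))).card} ≤
      ENNReal.ofReal (Real.exp (-(n / 200))) := by
  set u := (unplaced (P ω i)).card with hu_def
  set x := B * n / 100 + 1 with hx
  have hBx : B * n ≤ 100 * x := by omega
  have hsub : {D : Draws n i | B * n < 100 * (unplaced (P (Function.update ω i D) (i + 1))).card} ⊆
      {D | x ≤ (unplaced (P (Function.update ω i D) (i + 1))).card} := by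
    intro D hD
    rw [Set.mem_ofPred_eq] at hD ⊢
    omega
  refine (measure_mono hsub).trans ((measure_le_card_le
    (fun D => hP.unplaced_update_subset ω i D) x (p := ENNReal.ofReal r ^ x)
    fun X hX hXx => ?_).trans ?_)
  · refine (hP.reqLaw_subset_unplaced_le ω i hX (r := r) ?_).trans_eq (by rw [hK, hXx, one_mul])
    have hxu : x ≤ u := hXx ▸ Finset.card_le_card hX
    have h1 := two_mul_card_fullBins_add_card_unplaced_le (P ω i)
    have h2 : 200 * ((fullBins (P ω i)).card + numReq n i * (u - X.card)) + 2 * (B * n) ≤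
        100 * n + A * n := by rw [hK, hXx]; omega
    have h3 : (200 : ℝ) * (((fullBins (P ω i)).card + numReq n i * (u - X.card) : ℕ) : ℝ) +
        2 * (B * n) ≤ 100 * n + A * n := by exact_mod_cast h2
    have h4 : ((100 + A) / 200 - B / 100) * (n : ℝ) ≤ r * n := by gcongr
    linarith
  · rw [← hu_def, ← ENNReal.ofReal_pow hr0, ← ENNReal.ofReal_natCast,
      ← ENNReal.ofReal_mul (Nat.cast_nonneg _)]
    refine ENNReal.ofReal_le_ofReal ?_
    have hrz1 : r / z ≤ 1 := (div_le_one hz).2 hrz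
    have hrz0 : 0 ≤ r / z := div_nonneg hr0 hz.le
    have h1 : (u.choose x : ℝ) * r ^ x ≤ (1 + z) ^ u * (r / z) ^ x := by
      have h := mul_le_mul_of_nonneg_right (choose_mul_pow_le hz.le u x) (pow_nonneg hrz0 x)
      rwa [mul_assoc, ← mul_pow, mul_div_cancel₀ _ hz.ne'] at h
    refine le_of_pow_le_pow_left₀ (n := 100) (by norm_num) (Real.exp_pos _).le ?_
    calc ((u.choose x : ℝ) * r ^ x) ^ 100 ≤ ((1 + z) ^ u * (r / z) ^ x) ^ 100 := by gcongr
      _ = (1 + z) ^ (100 * u) * (r / z) ^ (100 * x) := by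
        rw [mul_pow, ← pow_mul, ← pow_mul, mul_comm u, mul_comm x]
      _ ≤ (1 + z) ^ (A * n) * (r / z) ^ (B * n) :=
        mul_le_mul (pow_le_pow_right₀ (by linarith) hu) (pow_le_pow_of_le_one hrz0 hrz1 hBx)
          (by positivity) (by positivity)
      _ = ((1 + z) ^ A * (r / z) ^ B) ^ n := by rw [mul_pow, ← pow_mul, ← pow_mul]
      _ ≤ (1 / 2) ^ n := by gcongr
      _ ≤ Real.exp (-(1 / 2)) ^ n := by
        gcongr
        have := Real.add_one_le_exp (-(1 / 2) : ℝ)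
        linarith
      _ = Real.exp (-(n / 200)) ^ 100 := by
        rw [← Real.exp_nat_mul, ← Real.exp_nat_mul]; congr 1; push_cast; ring

/-- A round with `K ≥ 2` requests per ball and at most `n / 4` requests. The expected number of
balls left is at most `(3/4)^K u`, which is smaller than the threshold `x ≥ (9/10) e^{-K/10} u` by a
constant factor, so that Chernoff's bound with base `7/5` applies. -/
theorem reqLaw_lt_unplaced_le_of_four_mul_le (ω : Sample n) (i : ℕ) (hK : 2 ≤ numReq n i)
    (hM : 4 * ((unplaced (P ω i)).card * numReq n i) ≤ n) {x : ℝ}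
    (hx : 9 / 10 * ((unplaced (P ω i)).card : ℝ) ≤ Real.exp ((numReq n i : ℝ) / 10) * x) :
    reqLaw n (numReq n i) {D | x < (unplaced (P (Function.update ω i D) (i + 1))).card} ≤
      ENNReal.ofReal (Real.exp (-(x / 50))) := by
  set u := (unplaced (P ω i)).card with hu_def
  set K := numReq n i with hK_def
  have hx0 : 0 ≤ x := by
    by_contra h
    have h1 : Real.exp ((K : ℝ) / 10) * x < 0 := mul_neg_of_pos_of_neg (Real.exp_pos _) (not_le.1 h)
    have h2 : (0 : ℝ) ≤ 9 / 10 * (u : ℝ) := by positivity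
    linarith
  have hq : (3 / 4) ^ K * Real.exp ((K : ℝ) / 10) ≤ (83 / 100) ^ 2 :=
    (three_quarters_pow_mul_exp_le K).trans
      (pow_le_pow_of_le_one (by norm_num) (by norm_num) hK)
  have hqu : (3 / 4) ^ K * (u : ℝ) ≤ (83 / 100) ^ 2 * (10 / 9 * x) := by
    have h1 : (u : ℝ) ≤ Real.exp ((K : ℝ) / 10) * (10 / 9 * x) := by linarith
    calc (3 / 4) ^ K * (u : ℝ) ≤ (3 / 4) ^ K * (Real.exp ((K : ℝ) / 10) * (10 / 9 * x)) := by gcongr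
      _ = (3 / 4) ^ K * Real.exp ((K : ℝ) / 10) * (10 / 9 * x) := by ring
      _ ≤ _ := by gcongr
  have hmgf := hP.lintegral_one_add_pow_unplaced_le ω i hM (ENNReal.ofReal (2 / 5))
  have h75 : 1 + ENNReal.ofReal (2 / 5) = ENNReal.ofReal (7 / 5) := by
    rw [← ENNReal.ofReal_one, ← ENNReal.ofReal_add (by norm_num) (by norm_num)]
    norm_num
  rw [h75, ← ENNReal.ofReal_pow (by norm_num), ← ENNReal.ofReal_mul (by norm_num),
    ← ENNReal.ofReal_one, ← ENNReal.ofReal_add (by norm_num) (by positivity),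
    ← ENNReal.ofReal_pow (by positivity)] at hmgf
  refine (measure_lt_natCast_le (Measurable.of_discrete
    (f := fun D => (unplaced (P (Function.update ω i D) (i + 1))).card))
    (by norm_num) hmgf x).trans (ENNReal.ofReal_le_ofReal ?_)
  have h1 : (1 + 2 / 5 * (3 / 4) ^ K : ℝ) ^ u ≤ Real.exp (2 / 5 * ((3 / 4) ^ K * u)) := by
    calc (1 + 2 / 5 * (3 / 4) ^ K : ℝ) ^ u ≤ Real.exp (2 / 5 * (3 / 4) ^ K) ^ u := by
          gcongr
          rw [add_comm]; exact Real.add_one_le_exp _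
      _ = _ := by rw [← Real.exp_nat_mul]; congr 1; ring
  have h2 : Real.exp (x / 3) ≤ (7 / 5 : ℝ) ^ x := by
    have h3 : Real.exp (1 / 3) ≤ 7 / 5 := by
      refine le_of_pow_le_pow_left₀ (n := 3) (by norm_num) (by norm_num) ?_
      rw [← Real.exp_nat_mul]
      have h1 := Real.exp_one_lt_d9
      norm_num at h1 ⊢
      linarith
    calc Real.exp (x / 3) = Real.exp (1 / 3) ^ x := by rw [← Real.exp_mul]; congr 1; ring
      _ ≤ _ := Real.rpow_le_rpow (Real.exp_pos _).le h3 hx0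
  calc (1 + 2 / 5 * (3 / 4) ^ K : ℝ) ^ u / (7 / 5 : ℝ) ^ x
      ≤ Real.exp (2 / 5 * ((3 / 4) ^ K * u)) / Real.exp (x / 3) := by gcongr
    _ = Real.exp (2 / 5 * ((3 / 4) ^ K * u) - x / 3) := (Real.exp_sub _ _).symm
    _ ≤ Real.exp (-(x / 50)) := by
      refine Real.exp_le_exp.2 ?_
      linarith

end IsExecution

/-! ### The bounds on the number of unplaced balls -/

/-- Percentage of the balls that may be left at the beginning of the first rounds. -/
def earlyPercent : ℕ → ℕ
  | 0 => 100
  | 1 => 67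
  | 2 => 46
  | 3 => 34
  | 4 => 25
  | 5 => 19
  | 6 => 15
  | _ => 12

/-- Bound on the number of balls that are left at the beginning of round `i`. From round `7` on,
the bound on the number of requests decreases geometrically, until the balls left are so few that
the trivial estimate suffices. -/
noncomputable def unplacedBound (n i : ℕ) : ℝ :=
  if i < 7 then earlyPercent i * n / 100
  else max ((9 / 10) ^ (i - 7) * (n / (4 * kParam n i))) (n / Real.logb 2 n ^ 2)

/-- Bound on the probability that a round violates the bound on the number of unplaced balls. -/
noncomputable def roundError (n : ℕ) : ℝ := Real.exp (-(n / (50 * Real.logb 2 n ^ 2)))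

theorem roundError_nonneg (n : ℕ) : 0 ≤ roundError n := (Real.exp_pos _).le

section

variable {n : ℕ} (hL : 4 ≤ Real.logb 2 n)
include hL

theorem unplacedBound_mul_kParam_le {i : ℕ} (hi : 7 ≤ i) :
    unplacedBound n i * kParam n i ≤
      max ((9 / 10) ^ (i - 7) * ((n : ℝ) / 4)) ((n : ℝ) / Real.logb 2 n) := by
  have hk := one_le_kParam hL i
  have hkL := kParam_le_logb hL i
  rw [unplacedBound, if_neg (by omega), max_mul_of_nonneg _ _ (by linarith)]
  refine max_le_max (le_of_eq ?_) ?_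
  · field_simp
  · calc (n : ℝ) / Real.logb 2 n ^ 2 * kParam n i ≤ n / Real.logb 2 n ^ 2 * Real.logb 2 n := by
          gcongr
      _ = _ := by field_simp

theorem four_mul_le_of_le_unplacedBound {i : ℕ} (hi : 7 ≤ i) {u : ℕ}
    (hu : (u : ℝ) ≤ unplacedBound n i) : 4 * (u * numReq n i) ≤ n := by
  have hb : 0 ≤ unplacedBound n i := (Nat.cast_nonneg u).trans hu
  have h : unplacedBound n i * kParam n i ≤ n / 4 := by
    refine (unplacedBound_mul_kParam_le hL hi).trans (max_le ?_ ?_)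
    · exact mul_le_of_le_one_left (by positivity) (pow_le_one₀ (by norm_num) (by norm_num))
    · gcongr
  have h2 : (u : ℝ) * numReq n i ≤ n / 4 := by
    refine le_trans ?_ h
    have := numReq_le_kParam hL i
    gcongr
  have h3 : (4 : ℝ) * (u * numReq n i) ≤ n := by linarith
  exact_mod_cast h3

theorem earlyPercent_le_unplacedBound {i : ℕ} (hi : i ≤ 7) :
    (earlyPercent i * n / 100 : ℝ) ≤ unplacedBound n i := by
  rw [unplacedBound]
  split_ifs with h
  · exact le_rfl
  · obtain rfl : i = 7 := by omega
    refine le_trans ?_ (le_max_left _ _)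
    have h1 := kParam_seven_le hL
    have h2 := one_le_kParam hL 7
    have h3 : (n : ℝ) / (4 * (25 / 12)) ≤ n / (4 * kParam n 7) := by gcongr
    simp only [earlyPercent, Nat.sub_self, pow_zero, one_mul]
    refine le_trans (le_of_eq ?_) h3
    push_cast; ring

/-- Each round preserves the bound on the number of unplaced balls, up to a small probability. -/
theorem IsExecution.reqLaw_unplacedBound_lt_le [NeZero n] {P : Sample n → ℕ → Placement n}
    (hP : IsExecution P) (ω : Sample n) (i : ℕ)
    (hu : ((unplaced (P ω i)).card : ℝ) ≤ unplacedBound n i) :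
    reqLaw n (numReq n i)
      {D | unplacedBound n (i + 1) < (unplaced (P (Function.update ω i D) (i + 1))).card} ≤
      ENNReal.ofReal (roundError n) := by
  rcases le_or_gt i 6 with hi | hi
  · have hK := numReq_eq_one hL hi
    have hu' : 100 * (unplaced (P ω i)).card ≤ earlyPercent i * n := by
      rw [unplacedBound, if_pos (by omega)] at hu
      have : (100 : ℝ) * (unplaced (P ω i)).card ≤ earlyPercent i * n := by linarith
      exact_mod_cast this
    have key : reqLaw n (numReq n i) {D | earlyPercent (i + 1) * n <
        100 * (unplaced (P (Function.update ω i D) (i + 1))).card} ≤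
        ENNReal.ofReal (Real.exp (-(n / 200))) := by
      have hi' := hi
      -- `z = B / (A - B)` and `r = (100 + A) / 200 - B / 100` for the percentages `A` and `B`
      interval_cases i
      · exact hP.reqLaw_lt_unplaced_le_of_numReq_eq_one ω 0 hK hu' (z := 67 / 33) (r := 33 / 100)
          (by norm_num) (by norm_num [earlyPercent]) (by norm_num) (by norm_num)
          (by norm_num [earlyPercent])
      · exact hP.reqLaw_lt_unplaced_le_of_numReq_eq_one ω 1 hK hu' (z := 46 / 21) (r := 75 / 200)
          (by norm_num) (by norm_num [earlyPercent]) (by norm_num) (by norm_num)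
          (by norm_num [earlyPercent])
      · exact hP.reqLaw_lt_unplaced_le_of_numReq_eq_one ω 2 hK hu' (z := 34 / 12) (r := 39 / 100)
          (by norm_num) (by norm_num [earlyPercent]) (by norm_num) (by norm_num)
          (by norm_num [earlyPercent])
      · exact hP.reqLaw_lt_unplaced_le_of_numReq_eq_one ω 3 hK hu' (z := 25 / 9) (r := 42 / 100)
          (by norm_num) (by norm_num [earlyPercent]) (by norm_num) (by norm_num)
          (by norm_num [earlyPercent])
      · exact hP.reqLaw_lt_unplaced_le_of_numReq_eq_one ω 4 hK hu' (z := 19 / 6) (r := 87 / 200)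
          (by norm_num) (by norm_num [earlyPercent]) (by norm_num) (by norm_num)
          (by norm_num [earlyPercent])
      · exact hP.reqLaw_lt_unplaced_le_of_numReq_eq_one ω 5 hK hu' (z := 15 / 4) (r := 89 / 200)
          (by norm_num) (by norm_num [earlyPercent]) (by norm_num) (by norm_num)
          (by norm_num [earlyPercent])
      · exact hP.reqLaw_lt_unplaced_le_of_numReq_eq_one ω 6 hK hu' (z := 4) (r := 91 / 200)
          (by norm_num) (by norm_num [earlyPercent]) (by norm_num) (by norm_num)
          (by norm_num [earlyPercent])
    refine (measure_mono ?_).trans (key.trans (ENNReal.ofReal_le_ofReal ?_))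
    · intro D hD
      rw [Set.mem_ofPred_eq] at hD ⊢
      have h := (earlyPercent_le_unplacedBound hL (show i + 1 ≤ 7 by omega)).trans_lt hD
      have h2 : (earlyPercent (i + 1) * n : ℝ) <
          100 * (unplaced (P (Function.update ω i D) (i + 1))).card := by linarith
      exact_mod_cast h2
    · refine Real.exp_le_exp.2 (neg_le_neg ?_)
      have : (200 : ℝ) ≤ 50 * Real.logb 2 n ^ 2 := by nlinarith
      gcongr
  · have hL0 : 0 < Real.logb 2 n := by linarith
    have hb' : unplacedBound n (i + 1) = max ((9 / 10) ^ (i + 1 - 7) * (n / (4 * kParam n (i + 1))))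
      (n / Real.logb 2 n ^ 2) := by rw [unplacedBound, if_neg (by omega)]
    rcases le_or_gt ((unplaced (P ω i)).card : ℝ) (n / Real.logb 2 n ^ 2) with hsmall | hlarge
    · -- the target bound is at least the current number of unplaced balls
      have hempty : {D : Draws n i |
          unplacedBound n (i + 1) < (unplaced (P (Function.update ω i D) (i + 1))).card} = ∅ := by
        refine Set.eq_empty_of_forall_notMem fun D hD => ?_
        rw [Set.mem_ofPred_eq] at hD
        have h1 : ((unplaced (P (Function.update ω i D) (i + 1))).card : ℝ) ≤
            (unplaced (P ω i)).card := by
          exact_mod_cast Finset.card_le_card (hP.unplaced_update_subset ω i D)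
        have h2 : (n : ℝ) / Real.logb 2 n ^ 2 ≤ unplacedBound n (i + 1) := by
          rw [hb']; exact le_max_right _ _
        linarith
      have h0 : reqLaw n (numReq n i) {D : Draws n i |
          unplacedBound n (i + 1) < (unplaced (P (Function.update ω i D) (i + 1))).card} = 0 := by
        rw [hempty]; exact measure_empty
      exact h0.trans_le zero_le
    · have hb : ((unplaced (P ω i)).card : ℝ) ≤ (9 / 10) ^ (i - 7) * (n / (4 * kParam n i)) := by
        rw [unplacedBound, if_neg (by omega)] at hu
        rcases le_max_iff.1 hu with h | h
        · exact h
        · linarith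
      refine (hP.reqLaw_lt_unplaced_le_of_four_mul_le ω i (two_le_numReq hL hi)
        (four_mul_le_of_le_unplacedBound hL hi hu) (x := unplacedBound n (i + 1)) ?_).trans
        (ENNReal.ofReal_le_ofReal (Real.exp_le_exp.2 (neg_le_neg ?_)))
      · have hk := one_le_kParam hL i
        have hk' := one_le_kParam hL (i + 1)
        have hE := Real.exp_pos ((numReq n i : ℝ) / 10)
        calc 9 / 10 * ((unplaced (P ω i)).card : ℝ)
            ≤ 9 / 10 * ((9 / 10) ^ (i - 7) * (n / (4 * kParam n i))) := by gcongr
          _ = Real.exp ((numReq n i : ℝ) / 10) * ((9 / 10) ^ (i + 1 - 7) *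
              (n / (4 * (kParam n i * Real.exp ((numReq n i : ℝ) / 10))))) := by
            rw [show i + 1 - 7 = i - 7 + 1 by omega, pow_succ]
            field_simp
          _ ≤ Real.exp ((numReq n i : ℝ) / 10) * ((9 / 10) ^ (i + 1 - 7) *
              (n / (4 * kParam n (i + 1)))) := by
            have := kParam_succ_le (n := n) i
            gcongr
          _ ≤ _ := by
            rw [hb']
            gcongr
            exact le_max_left _ _
      · calc (n : ℝ) / (50 * Real.logb 2 n ^ 2) = n / Real.logb 2 n ^ 2 / 50 := by
              rw [div_div, mul_comm]
          _ ≤ unplacedBound n (i + 1) / 50 := by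
            rw [hb']
            gcongr
            exact le_max_right _ _

end

/-! ### The whole execution -/

theorem measurableSet_of_adapted {n : ℕ} {A : Set (Sample n)} (i : ℕ)
    (hA : ∀ ω ω', (∀ j < i, ω j = ω' j) → ω ∈ A → ω' ∈ A) : MeasurableSet A := by
  refine measurableSet_setOfPred.2 (measurable_of_adapted (fun ω => ω ∈ A) i fun ω ω' h => ?_)
  exact propext ⟨hA ω ω' h, hA ω' ω fun j hj => (h j hj).symm⟩

theorem update_mem_iff {n i : ℕ} {A : Set (Sample n)}
    (hA : ∀ ω ω', (∀ j < i, ω j = ω' j) → ω ∈ A → ω' ∈ A) (ω : Sample n) (D : Draws n i) :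
    Function.update ω i D ∈ A ↔ ω ∈ A := by
  have h : ∀ j < i, Function.update ω i D j = ω j := fun j hj => Function.update_of_ne (by omega) _ _
  exact ⟨hA _ _ h, hA _ _ fun j hj => (h j hj).symm⟩

/-- If, given the other rounds, round `i` leads into `A` with probability at most `p`, and only from
`B`, then `A` is at most `p` times as likely as `B`. -/
theorem law_le_mul {n : ℕ} [NeZero n] (i : ℕ) {A B : Set (Sample n)} (hA : MeasurableSet A)
    (hB : MeasurableSet B) {p : ℝ≥0∞}
    (hAB : ∀ ω (D : Draws n i), Function.update ω i D ∈ A → ω ∈ B)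
    (hp : ∀ ω ∈ B, reqLaw n (numReq n i) {D | Function.update ω i D ∈ A} ≤ p) :
    law n A ≤ p * law n B := by
  rw [← lintegral_indicator_one hA, ← lintegral_indicator_const hB]
  refine lintegral_law_le i (measurable_one.indicator hA) fun ω => ?_
  have h : ∀ D : Draws n i, A.indicator (1 : Sample n → ℝ≥0∞) (Function.update ω i D) =
      {D : Draws n i | Function.update ω i D ∈ A}.indicator 1 D := fun D => rfl
  simp only [h]
  rw [lintegral_indicator_one MeasurableSet.of_discrete]
  by_cases hω : ω ∈ B
  · rw [Set.indicator_of_mem hω]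
    exact hp ω hω
  · have hempty : {D : Draws n i | Function.update ω i D ∈ A} = ∅ :=
      Set.eq_empty_of_forall_notMem fun D hD => hω (hAB ω D hD)
    rw [hempty, measure_empty]
    exact zero_le

/-- Bound on the probability that a given ball survives the rounds before `i`, all of which (from
round `7` on) have at most `n / 4` requests. -/
noncomputable def survivalBound (n i : ℕ) : ℝ := ∏ j ∈ Finset.Ico 7 i, (3 / 4) ^ numReq n j

namespace IsExecution

variable {n : ℕ} {P : Sample n → ℕ → Placement n} (hP : IsExecution P)
include hP

theorem requestsAt_update (w : Fin n) (ω : Sample n) (i : ℕ) (D : Draws n i) :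
    requestsAt (P (Function.update ω i D)) (Function.update ω i D) w i =
      (Finset.univ.filter fun r : Fin n × Fin (numReq n i) =>
        r.1 ∈ unplaced (P ω i) ∧ D r.1 r.2 = w).card := by
  unfold requestsAt
  simp only [hP.update_eq ω i D le_rfl, Function.update_self, mem_unplaced]

theorem requestsAt_congr (w : Fin n) {i j : ℕ} (hj : j < i) {ω ω' : Sample n}
    (h : ∀ k < i, ω k = ω' k) : requestsAt (P ω) ω w j = requestsAt (P ω') ω' w j := by
  unfold requestsAt
  rw [hP.adapted j ω ω' fun k hk => h k (by omega), h j hj]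

theorem measurable_requestsAt (w : Fin n) (i : ℕ) :
    Measurable fun ω => requestsAt (P ω) ω w i :=
  measurable_of_adapted _ (i + 1) fun _ _ h => hP.requestsAt_congr w (Nat.lt_succ_self i) h

variable [NeZero n]

/-- The union bound over the first round that violates the bound on the unplaced balls. -/
theorem law_exists_unplacedBound_lt_le (hL : 4 ≤ Real.logb 2 n) (m : ℕ) :
    law n {ω | ∃ j ≤ m, unplacedBound n j < (unplaced (P ω j)).card} ≤
      m * ENNReal.ofReal (roundError n) := by
  have hsub : {ω | ∃ j ≤ m, unplacedBound n j < (unplaced (P ω j)).card} ⊆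
      ⋃ j ∈ Finset.range m, {ω | ((unplaced (P ω j)).card : ℝ) ≤ unplacedBound n j ∧
        unplacedBound n (j + 1) < (unplaced (P ω (j + 1))).card} := by
    rintro ω ⟨j, hjm, hj⟩
    simp only [Set.mem_iUnion, Finset.mem_range]
    induction j with
    | zero =>
      exfalso
      have h0 : unplacedBound n 0 = n := by simp [unplacedBound, earlyPercent]
      have h1 : ((unplaced (P ω 0)).card : ℝ) ≤ n := by exact_mod_cast card_unplaced_le _
      linarith
    | succ j ih =>
      by_cases h : unplacedBound n j < (unplaced (P ω j)).card
      · exact ih (by omega) h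
      · exact ⟨j, by omega, not_lt.1 h, hj⟩
  refine (measure_mono hsub).trans ((measure_biUnion_finset_le _ _).trans ?_)
  refine (Finset.sum_le_card_nsmul _ _ (ENNReal.ofReal (roundError n)) fun j _ => ?_).trans
    (by rw [Finset.card_range, nsmul_eq_mul])
  refine (law_le_mul j (A := {ω | ((unplaced (P ω j)).card : ℝ) ≤ unplacedBound n j ∧
        unplacedBound n (j + 1) < (unplaced (P ω (j + 1))).card})
        (B := {ω | ((unplaced (P ω j)).card : ℝ) ≤ unplacedBound n j})
    (measurableSet_of_adapted (j + 1) ?_) (measurableSet_of_adapted j ?_) ?_ fun ω hω => ?_).trans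
    (mul_le_of_le_one_right zero_le prob_le_one)
  · rintro ω ω' h ⟨h1, h2⟩
    rw [hP.adapted _ ω ω' h] at h2
    rw [hP.adapted _ ω ω' fun k hk => h k (by omega)] at h1
    exact ⟨h1, h2⟩
  · intro ω ω' h h1
    rw [Set.mem_ofPred_eq, hP.adapted _ ω ω' h] at h1
    exact h1
  · intro ω D hD
    have := hD.1
    rwa [hP.update_eq ω j D le_rfl] at this
  · exact (measure_mono fun D hD => hD.2).trans (hP.reqLaw_unplacedBound_lt_le hL ω j hω)

theorem law_unplaced_of_few_requests_le (v : Fin n) (i : ℕ) :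
    law n {ω | P ω i v = none ∧ ∀ j, 7 ≤ j → j < i →
      4 * ((unplaced (P ω j)).card * numReq n j) ≤ n} ≤ ENNReal.ofReal (survivalBound n i) := by
  have hmeas : ∀ i k, k ≤ i + 1 → MeasurableSet {ω | P ω i v = none ∧ ∀ j, 7 ≤ j → j < k →
      4 * ((unplaced (P ω j)).card * numReq n j) ≤ n} := by
    intro i k hk
    refine measurableSet_of_adapted i ?_
    rintro ω ω' h ⟨h1, h2⟩
    refine ⟨by rwa [← hP.adapted _ ω ω' h], fun j hj hj' => ?_⟩
    rw [← hP.adapted j ω ω' fun k hk => h k (by omega)]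
    exact h2 j hj hj'
  induction i with
  | zero => exact prob_le_one.trans (by simp [survivalBound])
  | succ i ih =>
    rcases lt_or_ge i 7 with hi | hi
    · refine prob_le_one.trans ?_
      rw [survivalBound, Finset.Ico_eq_empty (by omega)]
      simp
    · rw [survivalBound, Finset.prod_Ico_succ_top hi, mul_comm,
        ENNReal.ofReal_mul (by positivity), ENNReal.ofReal_pow (by norm_num)]
      refine (law_le_mul i (hmeas (i + 1) (i + 1) (by omega)) (hmeas i (i + 1) le_rfl)
        (fun ω D hD => ?_) fun ω hω => ?_).trans (mul_le_mul_right (le_trans ?_ ih) _)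
      · refine ⟨?_, fun j hj hj' => ?_⟩
        · have := hP.eq_none_of_succ hD.1
          rwa [hP.update_eq ω i D le_rfl] at this
        · have := hD.2 j hj hj'
          rwa [hP.update_eq ω i D (by omega)] at this
      · refine le_trans (measure_mono fun D hD => ?_)
          (hP.reqLaw_eq_none_le ω i (hω.2 i hi (by omega)) hω.1)
        exact hD.1
      · exact measure_mono fun ω hω => ⟨hω.1, fun j hj hj' => hω.2 j hj (by omega)⟩

/-- In each round at least one further ball is placed with probability at least `1/2`, hence
the number of rounds has a geometric tail, at the rate of `1/n`. -/
theorem law_unplaced_nonempty_le (hL : 4 ≤ Real.logb 2 n) (i : ℕ) :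
    law n {ω | (unplaced (P ω i)).Nonempty} ≤
      ENNReal.ofReal (3 * (1 - 1 / (2 * (n + 1))) ^ i) := by
  have hn : (0 : ℝ) < n := by exact_mod_cast Nat.pos_of_ne_zero (NeZero.ne n)
  set a : ℝ := 1 + 1 / n with ha
  have ha1 : 1 ≤ a := by rw [ha]; exact le_add_of_nonneg_right (by positivity)
  have ha0 : 0 < a := by linarith
  set l : ℝ := 1 - 1 / (2 * (n + 1)) with hl
  have hla : l = a⁻¹ + (1 - a⁻¹) * 2⁻¹ := by rw [hl, ha]; field_simp; ring
  have ha1' : a⁻¹ ≤ 1 := inv_le_one_of_one_le₀ ha1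
  have ha0' : 0 < a⁻¹ := inv_pos.2 ha0
  have hl0 : 0 ≤ l := by rw [hla]; nlinarith
  -- the potential is `a ^ u` as long as there are `u > 0` unplaced balls
  let φ : Placement n → ℝ≥0∞ := fun Q =>
    if (unplaced Q).Nonempty then ENNReal.ofReal a ^ (unplaced Q).card else 0
  have key : ∫⁻ ω, φ (P ω i) ∂law n ≤ ENNReal.ofReal (3 * l ^ i) := by
    induction i with
    | zero =>
      refine (lintegral_mono (g := fun _ => ENNReal.ofReal 3) fun ω => ?_).trans (by simp)
      simp only [φ]
      split_ifs
      · rw [← ENNReal.ofReal_pow ha0.le]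
        refine ENNReal.ofReal_le_ofReal ?_
        calc a ^ (unplaced (P ω 0)).card ≤ a ^ n := pow_le_pow_right₀ ha1 (card_unplaced_le _)
          _ ≤ Real.exp (1 / n) ^ n := by
            gcongr
            rw [ha, add_comm]; exact Real.add_one_le_exp _
          _ = Real.exp 1 := by rw [← Real.exp_nat_mul]; congr 1; field_simp
          _ ≤ 3 := by linarith [Real.exp_one_lt_d9]
      · exact zero_le
    | succ i ih =>
      have hstep : ∀ ω, ∫⁻ D, φ (P (Function.update ω i D) (i + 1)) ∂reqLaw n (numReq n i) ≤
          ENNReal.ofReal l * φ (P ω i) := by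
        intro ω
        by_cases hu : (unplaced (P ω i)).Nonempty
        · have hφ : φ (P ω i) = ENNReal.ofReal a ^ (unplaced (P ω i)).card := if_pos hu
          set S := {D : Draws n i |
            unplaced (P ω i) ⊆ unplaced (P (Function.update ω i D) (i + 1))} with hS
          have hpt : ∀ D, φ (P (Function.update ω i D) (i + 1)) ≤ φ (P ω i) *
              (ENNReal.ofReal a⁻¹ + S.indicator (fun _ => ENNReal.ofReal (1 - a⁻¹)) D) := by
            intro D
            rw [hφ]
            refine le_trans (b := ENNReal.ofReal a ^
              (unplaced (P (Function.update ω i D) (i + 1))).card) ?_ ?_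
            · simp only [φ]; split_ifs
              · exact le_rfl
              · exact zero_le
            · have hsub := hP.unplaced_update_subset ω i D
              by_cases hD : D ∈ S
              · rw [Set.indicator_of_mem hD, ← ENNReal.ofReal_add ha0'.le (by linarith),
                  Finset.Subset.antisymm hsub hD]
                simp
              · rw [Set.indicator_of_notMem hD, add_zero, ← ENNReal.ofReal_pow ha0.le,
                  ← ENNReal.ofReal_pow ha0.le, ← ENNReal.ofReal_mul (by positivity)]
                have hlt := Finset.card_lt_card (hsub.ssubset_of_not_subset hD)
                obtain ⟨k, hk⟩ := Nat.exists_eq_add_of_lt hlt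
                refine ENNReal.ofReal_le_ofReal ?_
                rw [hk, pow_succ, mul_assoc, mul_inv_cancel₀ ha0.ne', mul_one]
                exact pow_le_pow_right₀ ha1 (by omega)
          refine (lintegral_mono hpt).trans ?_
          rw [lintegral_const_mul _ Measurable.of_discrete, lintegral_add_left measurable_const,
            lintegral_const, measure_univ, mul_one,
            lintegral_indicator_const MeasurableSet.of_discrete, mul_comm]
          refine mul_le_mul_left ?_ _
          have hp := hP.reqLaw_unplaced_eq_le ω i (Nat.pos_iff_ne_zero.1 (one_le_numReq hL i)) hu
          rw [hla, ENNReal.ofReal_add ha0'.le (by nlinarith), ENNReal.ofReal_mul (by linarith),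
            ENNReal.ofReal_inv_of_pos (by norm_num : (0 : ℝ) < 2), ENNReal.ofReal_ofNat]
          gcongr
        · have h0 : ∀ D, φ (P (Function.update ω i D) (i + 1)) = 0 := fun D =>
            if_neg fun h => hu (h.mono (hP.unplaced_update_subset ω i D))
          simp [h0]
      refine (lintegral_law_le i (hP.measurable_comp (i + 1) φ) hstep).trans ?_
      rw [lintegral_const_mul _ (hP.measurable_comp i φ)]
      refine (mul_le_mul_right ih _).trans_eq ?_
      rw [← ENNReal.ofReal_mul hl0]
      congr 1
      ring
  refine le_trans ?_ key
  have hmeas : MeasurableSet {ω | (unplaced (P ω i)).Nonempty} :=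
    measurableSet_of_adapted i fun ω ω' h h1 => by
      rwa [Set.mem_ofPred_eq, ← hP.adapted i ω ω' h]
  rw [← lintegral_indicator_one hmeas]
  refine lintegral_mono fun ω => ?_
  by_cases hω : (unplaced (P ω i)).Nonempty
  · rw [Set.indicator_of_mem (by exact hω)]
    simp only [φ, if_pos hω, Pi.one_apply]
    exact one_le_pow₀ (by rw [← ENNReal.ofReal_one]; exact ENNReal.ofReal_le_ofReal ha1)
  · rw [Set.indicator_of_notMem (by exact hω)]
    exact zero_le

/-! ### Requests arriving at a bin -/

theorem lintegral_requestsAt (w : Fin n) (i : ℕ) :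
    ∫⁻ ω, (requestsAt (P ω) ω w i : ℝ≥0∞) ∂law n =
      ∫⁻ ω, (((unplaced (P ω i)).card * numReq n i : ℕ) : ℝ≥0∞) * (n : ℝ≥0∞)⁻¹ ∂law n := by
  have hmeas : Measurable fun ω => (requestsAt (P ω) ω w i : ℝ≥0∞) :=
    (measurable_of_countable fun k : ℕ => (k : ℝ≥0∞)).comp (hP.measurable_requestsAt w i)
  rw [lintegral_law_eq_lintegral_update i hmeas]
  refine lintegral_congr fun ω => ?_
  simp only [hP.requestsAt_update w ω i]
  exact lintegral_card_requests _ _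

/-- The moment generating function of the number of requests that a bin receives, restricted to
the executions that obey given bounds on the number of all requests. -/
theorem lintegral_pow_sum_requestsAt_le (w : Fin n) {c : ℕ → ℝ} {a : ℝ} (ha : 1 ≤ a) (i : ℕ) :
    ∫⁻ ω, {ω | ∀ j < i, ((unplaced (P ω j)).card * numReq n j : ℝ) ≤ c j * n}.indicator
        (fun ω => ENNReal.ofReal a ^ ∑ j ∈ Finset.range i, requestsAt (P ω) ω w j) ω ∂law n ≤
      ENNReal.ofReal (Real.exp ((a - 1) * ∑ j ∈ Finset.range i, c j)) := by
  have hn : (0 : ℝ) < n := by exact_mod_cast Nat.pos_of_ne_zero (NeZero.ne n)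
  have hadapt : ∀ i k, i ≤ k + 1 → ∀ ω ω', (∀ j < k, ω j = ω' j) →
      ω ∈ {ω | ∀ j < i, ((unplaced (P ω j)).card * numReq n j : ℝ) ≤ c j * n} →
      ω' ∈ {ω | ∀ j < i, ((unplaced (P ω j)).card * numReq n j : ℝ) ≤ c j * n} := by
    intro i k hik ω ω' h h1 j hj
    rw [← hP.adapted j ω ω' fun k hk => h k (by omega)]
    exact h1 j hj
  have hmeas : ∀ i, Measurable
      ({ω | ∀ j < i, ((unplaced (P ω j)).card * numReq n j : ℝ) ≤ c j * n}.indicator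
        (fun ω => ENNReal.ofReal a ^ ∑ j ∈ Finset.range i, requestsAt (P ω) ω w j)) := by
    intro i
    refine Measurable.indicator ?_ (measurableSet_of_adapted i (hadapt i i (by omega)))
    exact (measurable_of_countable fun k : ℕ => ENNReal.ofReal a ^ k).comp
      (Finset.measurable_fun_sum _ fun j _ => hP.measurable_requestsAt w j)
  induction i with
  | zero => simp
  | succ i ih =>
    rw [Finset.sum_range_succ, mul_add, Real.exp_add, mul_comm,
      ENNReal.ofReal_mul (Real.exp_pos _).le]
    refine le_trans ?_ (mul_le_mul_right ih _)
    rw [← lintegral_const_mul _ (hmeas i)]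
    refine lintegral_law_le i (hmeas (i + 1)) fun ω => ?_
    by_cases hω : ω ∈ {ω | ∀ j < i + 1, ((unplaced (P ω j)).card * numReq n j : ℝ) ≤ c j * n}
    · have hω' : ω ∈ {ω | ∀ j < i, ((unplaced (P ω j)).card * numReq n j : ℝ) ≤ c j * n} :=
        fun j hj => hω j (by omega)
      rw [Set.indicator_of_mem hω']
      have hD : ∀ D : Draws n i,
          {ω | ∀ j < i + 1, ((unplaced (P ω j)).card * numReq n j : ℝ) ≤ c j * n}.indicator
          (fun ω => ENNReal.ofReal a ^ ∑ j ∈ Finset.range (i + 1), requestsAt (P ω) ω w j)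
          (Function.update ω i D) =
          ENNReal.ofReal a ^ (∑ j ∈ Finset.range i, requestsAt (P ω) ω w j) *
          (1 + ENNReal.ofReal (a - 1)) ^ (Finset.univ.filter fun r : Fin n × Fin (numReq n i) =>
            r.1 ∈ unplaced (P ω i) ∧ D r.1 r.2 = w).card := by
        intro D
        rw [Set.indicator_of_mem ((update_mem_iff (hadapt (i + 1) i le_rfl) ω D).2 hω),
          Finset.sum_range_succ, pow_add, hP.requestsAt_update w ω i D, ← ENNReal.ofReal_one,
          ← ENNReal.ofReal_add zero_le_one (by linarith), add_sub_cancel]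
        congr 2
        refine Finset.sum_congr rfl fun j hj => ?_
        exact hP.requestsAt_congr w (Finset.mem_range.1 hj) fun k hk =>
          Function.update_of_ne (by omega) _ _
      simp only [hD]
      rw [lintegral_const_mul _ Measurable.of_discrete, mul_comm]
      refine mul_le_mul_left ((lintegral_one_add_pow_card_requests_le _ w _).trans ?_) _
      rw [← ENNReal.ofReal_natCast n, ← ENNReal.ofReal_inv_of_pos hn,
        ← ENNReal.ofReal_mul (by linarith), ← ENNReal.ofReal_one,
        ← ENNReal.ofReal_add zero_le_one (mul_nonneg (by linarith) (by positivity)),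
        ← ENNReal.ofReal_pow (add_nonneg zero_le_one (mul_nonneg (by linarith) (by positivity)))]
      refine ENNReal.ofReal_le_ofReal ?_
      have h1 : 0 ≤ (a - 1) * (n : ℝ)⁻¹ := mul_nonneg (by linarith) (by positivity)
      calc (1 + (a - 1) * (n : ℝ)⁻¹) ^ ((unplaced (P ω i)).card * numReq n i)
          ≤ Real.exp ((a - 1) * (n : ℝ)⁻¹) ^ ((unplaced (P ω i)).card * numReq n i) := by
            gcongr
            rw [add_comm]; exact Real.add_one_le_exp _
        _ = Real.exp ((a - 1) * ((n : ℝ)⁻¹ * ((unplaced (P ω i)).card * numReq n i))) := by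
            rw [← Real.exp_nat_mul]; congr 1; push_cast; ring
        _ ≤ Real.exp ((a - 1) * c i) := by
            refine Real.exp_le_exp.2 (mul_le_mul_of_nonneg_left ?_ (by linarith))
            rw [inv_mul_le_iff₀ hn, mul_comm (n : ℝ)]
            exact hω i (by omega)
    · have hD : ∀ D : Draws n i,
          {ω | ∀ j < i + 1, ((unplaced (P ω j)).card * numReq n j : ℝ) ≤ c j * n}.indicator
          (fun ω => ENNReal.ofReal a ^ ∑ j ∈ Finset.range (i + 1), requestsAt (P ω) ω w j)
          (Function.update ω i D) = 0 := fun D =>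
        Set.indicator_of_notMem
          (fun h => hω ((update_mem_iff (hadapt (i + 1) i le_rfl) ω D).1 h)) _
      rw [lintegral_congr hD, lintegral_zero]
      exact zero_le

end IsExecution

/-! ### Counting messages -/

theorem sum_requestsOf {n : ℕ} (P : Sample n → ℕ → Placement n) (ω : Sample n) (i : ℕ) :
    ∑ v, requestsOf (P ω) v i = (unplaced (P ω i)).card * numReq n i := by
  simp only [requestsOf]
  rw [← Finset.sum_filter, Finset.sum_const, smul_eq_mul]
  rfl

theorem sum_requestsAt {n : ℕ} (P : Sample n → ℕ → Placement n) (ω : Sample n) (i : ℕ) :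
    ∑ w, requestsAt (P ω) ω w i = (unplaced (P ω i)).card * numReq n i := by
  have h : (Finset.univ.filter fun r : Fin n × Fin (numReq n i) => P ω i r.1 = none) =
      unplaced (P ω i) ×ˢ Finset.univ := by ext r; simp
  have h2 := Finset.card_eq_sum_card_fiberwise (f := fun r : Fin n × Fin (numReq n i) => ω i r.1 r.2)
    (s := Finset.univ.filter fun r : Fin n × Fin (numReq n i) => P ω i r.1 = none)
    (t := Finset.univ) (by simp)
  rw [h, Finset.card_product, Finset.card_univ, Fintype.card_fin] at h2
  rw [h2, ← h]
  simp only [requestsAt, Finset.filter_filter]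

namespace IsExecution

variable {n : ℕ} {P : Sample n → ℕ → Placement n} (hP : IsExecution P)
include hP

theorem noticesOf_le_requestsOf (ω : Sample n) (v : Fin n) (i : ℕ) :
    noticesOf (P ω) v i ≤ requestsOf (P ω) v i := by
  unfold noticesOf requestsOf
  split_ifs with h1 h2 h2
  · obtain ⟨w, hw⟩ := Option.ne_none_iff_exists'.1 h1.2
    obtain ⟨j, -⟩ := hP.requested ω i v w h2 hw
    exact (Nat.zero_le _).trans_lt j.2
  · exact absurd h1.1 h2
  · exact Nat.zero_le _
  · exact le_rfl

theorem noticesAt_le_requestsAt (ω : Sample n) (w : Fin n) (i : ℕ) :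
    noticesAt (P ω) w i ≤ requestsAt (P ω) ω w i := by
  unfold noticesAt requestsAt
  refine (Finset.card_le_card ?_).trans (Finset.card_image_le (f := Prod.fst))
  intro v hv
  simp only [Finset.mem_filter, Finset.mem_univ, true_and] at hv
  obtain ⟨j, hj⟩ := hP.requested ω i v w hv.1 hv.2
  exact Finset.mem_image.2 ⟨(v, j), by simpa using ⟨hv.1, hj⟩, rfl⟩

theorem ballSent_le (ω : Sample n) (v : Fin n) : ballSent (P ω) v ≤ 2 * ballReceived (P ω) v := by
  unfold ballSent ballReceived
  rw [← ENNReal.tsum_mul_left]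
  refine ENNReal.tsum_le_tsum fun i => ?_
  have := hP.noticesOf_le_requestsOf ω v i
  exact_mod_cast (by omega : requestsOf (P ω) v i + noticesOf (P ω) v i ≤ 2 * requestsOf (P ω) v i)

theorem binReceived_le (ω : Sample n) (w : Fin n) :
    binReceived (P ω) ω w ≤ 2 * binSent (P ω) ω w := by
  unfold binReceived binSent
  rw [← ENNReal.tsum_mul_left]
  refine ENNReal.tsum_le_tsum fun i => ?_
  have := hP.noticesAt_le_requestsAt ω w i
  exact_mod_cast (by omega :
    requestsAt (P ω) ω w i + noticesAt (P ω) w i ≤ 2 * requestsAt (P ω) ω w i)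

theorem totalSent_le (ω : Sample n) :
    totalSent (P ω) ω ≤ 3 * ∑' i, (((unplaced (P ω i)).card * numReq n i : ℕ) : ℝ≥0∞) := by
  have h1 : ∑ v, ballReceived (P ω) v =
      ∑' i, (((unplaced (P ω i)).card * numReq n i : ℕ) : ℝ≥0∞) := by
    simp only [ballReceived]
    rw [← Summable.tsum_finsetSum fun _ _ => ENNReal.summable]
    exact tsum_congr fun i => by exact_mod_cast sum_requestsOf P ω i
  have h2 : ∑ w, binSent (P ω) ω w =
      ∑' i, (((unplaced (P ω i)).card * numReq n i : ℕ) : ℝ≥0∞) := by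
    simp only [binSent]
    rw [← Summable.tsum_finsetSum fun _ _ => ENNReal.summable]
    exact tsum_congr fun i => by exact_mod_cast sum_requestsAt P ω i
  rw [totalSent, h2]
  have h3 : ∑ v, ballSent (P ω) v ≤ 2 * ∑ v, ballReceived (P ω) v := by
    rw [Finset.mul_sum]
    exact Finset.sum_le_sum fun v _ => hP.ballSent_le ω v
  rw [h1] at h3
  refine (add_le_add_left h3 _).trans_eq ?_
  ring

end IsExecution

/-! ### Typical executions -/

/-- `m` is a round from which on the parameter has its final value `log n`, and which is reached
in the way described by `exists_saturation`. -/
structure IsSaturation (n m : ℕ) : Prop where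
  seven_le : 7 ≤ m
  le_logStar : m ≤ logStar n + 25
  kParam_eq : ∀ j, m ≤ j → kParam n j = Real.logb 2 n
  sum_le : ∑ i ∈ Finset.range m, kParam n i ≤ 11 * Real.logb 2 n

/-- The executions in which the number of unplaced balls obeys its bounds up to round `m`, and all
balls are placed `r` rounds later. -/
def typical {n : ℕ} (P : Sample n → ℕ → Placement n) (m r : ℕ) : Set (Sample n) :=
  {ω | (∀ j ≤ m, ((unplaced (P ω j)).card : ℝ) ≤ unplacedBound n j) ∧
    ∀ v, P ω (m + r) v ≠ none}

theorem IsSaturation.numReq_eq {n m : ℕ} (hm : IsSaturation n m) {j : ℕ} (hj : m ≤ j) :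
    numReq n j = numReq n m := by
  rw [numReq, numReq, hm.kParam_eq j hj, hm.kParam_eq m le_rfl]

theorem requestsOf_eq_zero_of_typical {n m r : ℕ} {P : Sample n → ℕ → Placement n}
    (hP : IsExecution P) {ω : Sample n} (hω : ω ∈ typical P m r) {i : ℕ}
    (hi : m + r ≤ i) (v : Fin n) : requestsOf (P ω) v i = 0 :=
  if_neg fun h => hω.2 v (hP.eq_none_of_le hi h)

theorem unplaced_eq_empty_of_typical {n m r : ℕ} {P : Sample n → ℕ → Placement n}
    (hP : IsExecution P) {ω : Sample n} (hω : ω ∈ typical P m r) {i : ℕ}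
    (hi : m + r ≤ i) : unplaced (P ω i) = ∅ :=
  Finset.eq_empty_of_forall_notMem fun v hv =>
    hω.2 v (hP.eq_none_of_le hi (mem_unplaced.1 hv))

theorem binSent_eq_of_typical {n m r : ℕ} {P : Sample n → ℕ → Placement n}
    (hP : IsExecution P) {ω : Sample n} (hω : ω ∈ typical P m r) (w : Fin n) :
    binSent (P ω) ω w = ((∑ i ∈ Finset.range (m + r), requestsAt (P ω) ω w i : ℕ) : ℝ≥0∞) := by
  rw [binSent, tsum_eq_sum (s := Finset.range (m + r)) fun i hi => ?_]
  · push_cast; rfl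
  · have h : requestsAt (P ω) ω w i ≤ 0 := by
      refine (Finset.single_le_sum (f := fun w => requestsAt (P ω) ω w i) (fun _ _ => Nat.zero_le _)
        (Finset.mem_univ w)).trans_eq ?_
      rw [sum_requestsAt, unplaced_eq_empty_of_typical hP hω (by simpa using hi)]
      simp
    simpa using h

/-- Bound, in units of `n`, on the number of requests of round `j` of a typical execution, if `m`
is the round of saturation. -/
noncomputable def requestBound (n m j : ℕ) : ℝ :=
  3 * (9 / 10) ^ j + 1 / Real.logb 2 n + if m ≤ j then 1 else 0

section

variable {n m r : ℕ} (hL : 4 ≤ Real.logb 2 n) (hm : IsSaturation n m)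
include hL hm

theorem IsSaturation.le_logb : (m : ℝ) ≤ 11 * Real.logb 2 n := by
  refine le_trans ?_ hm.sum_le
  have h := Finset.sum_le_sum fun i (_ : i ∈ Finset.range m) => one_le_kParam hL i
  simpa using h

theorem IsSaturation.sum_numReq_le :
    ((∑ i ∈ Finset.range (m + r), numReq n i : ℕ) : ℝ) ≤ (11 + r) * Real.logb 2 n := by
  rw [Finset.sum_range_add]
  push_cast
  have h1 : ∑ i ∈ Finset.range m, (numReq n i : ℝ) ≤ 11 * Real.logb 2 n :=
    (Finset.sum_le_sum fun i _ => numReq_le_kParam hL i).trans hm.sum_le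
  have h2 : ∑ i ∈ Finset.range r, (numReq n (m + i) : ℝ) ≤ r * Real.logb 2 n :=
    (Finset.sum_le_card_nsmul _ _ _ fun i _ => numReq_le_logb hL (m + i)).trans_eq (by simp)
  linarith

theorem sum_requestBound_le :
    ∑ j ∈ Finset.range (m + r), requestBound n m j ≤ 41 + 2 * r := by
  have hL0 : 0 < Real.logb 2 n := by linarith
  simp only [requestBound, Finset.sum_add_distrib]
  have h1 : ∑ j ∈ Finset.range (m + r), 3 * (9 / 10 : ℝ) ^ j ≤ 30 := by
    rw [← Finset.mul_sum, geom_sum_eq (by norm_num), show (9 / 10 - 1 : ℝ) = -(1 / 10) by norm_num,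
      div_neg, div_eq_mul_inv]
    norm_num
    have : (0 : ℝ) ≤ (9 / 10) ^ (m + r) := by positivity
    linarith
  have h2 : ∑ j ∈ Finset.range (m + r), 1 / Real.logb 2 n ≤ 11 + r := by
    rw [Finset.sum_const, Finset.card_range, nsmul_eq_mul, mul_one_div, div_le_iff₀ hL0]
    push_cast
    have := hm.le_logb hL
    have hr : (0 : ℝ) ≤ r := Nat.cast_nonneg r
    nlinarith
  have h3 : ∑ j ∈ Finset.range (m + r), (if m ≤ j then 1 else 0 : ℝ) = r := by
    rw [Finset.sum_range_add, Finset.sum_eq_zero fun j hj => if_neg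
      (not_le.2 (Finset.mem_range.1 hj)), zero_add, Finset.sum_congr rfl fun j _ =>
      if_pos (Nat.le_add_right m j)]
    simp
  linarith

variable {P : Sample n → ℕ → Placement n} (hP : IsExecution P)
include hP

theorem four_mul_le_of_forall_le_unplacedBound {ω : Sample n}
    (hω : ∀ j ≤ m, ((unplaced (P ω j)).card : ℝ) ≤ unplacedBound n j) {j : ℕ} (hj : 7 ≤ j) :
    4 * ((unplaced (P ω j)).card * numReq n j) ≤ n := by
  rcases le_or_gt j m with h | h
  · exact four_mul_le_of_le_unplacedBound hL hj (hω j h)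
  · refine le_trans ?_ (four_mul_le_of_le_unplacedBound hL hm.seven_le (hω m le_rfl))
    rw [hm.numReq_eq h.le]
    have := Finset.card_le_card (hP.unplaced_anti ω h.le)
    gcongr

theorem mul_numReq_le_of_typical {ω : Sample n} (hω : ω ∈ typical P m r) (j : ℕ) :
    (unplaced (P ω j)).card * numReq n j ≤ n := by
  rcases le_or_gt 7 j with h | h
  · have := four_mul_le_of_forall_le_unplacedBound hL hm hP hω.1 h
    omega
  · rw [numReq_eq_one hL (by omega), mul_one]
    exact card_unplaced_le _

theorem mul_numReq_le_requestBound {ω : Sample n} (hω : ω ∈ typical P m r) (j : ℕ) :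
    ((unplaced (P ω j)).card * numReq n j : ℝ) ≤ requestBound n m j * n := by
  have hL0 : 0 < Real.logb 2 n := by linarith
  have htriv : ((unplaced (P ω j)).card * numReq n j : ℝ) ≤ 1 * n := by
    rw [one_mul]; exact_mod_cast mul_numReq_le_of_typical hL hm hP hω j
  rcases le_or_gt m j with h | h
  · refine htriv.trans ?_
    gcongr
    rw [requestBound, if_pos h]
    exact le_add_of_nonneg_left (by positivity)
  · rw [requestBound, if_neg (not_le.2 h), add_zero]
    rcases lt_or_ge j 7 with h7 | h7
    · refine htriv.trans ?_
      gcongr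
      have h1 : (9 / 10 : ℝ) ^ 6 ≤ (9 / 10) ^ j :=
        pow_le_pow_of_le_one (by norm_num) (by norm_num) (by omega)
      have h2 : 0 ≤ 1 / Real.logb 2 n := by positivity
      norm_num at h1
      linarith
    · have h1 : ((unplaced (P ω j)).card * numReq n j : ℝ) ≤
          unplacedBound n j * kParam n j := by
        have := hω.1 j h.le
        have := numReq_le_kParam hL j
        have := (Nat.cast_nonneg _).trans (hω.1 j h.le)
        gcongr
      refine h1.trans ((unplacedBound_mul_kParam_le hL h7).trans ?_)
      refine (max_le_add_of_nonneg (by positivity) (by positivity)).trans ?_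
      have h2 : (9 / 10 : ℝ) ^ j = (9 / 10) ^ (j - 7) * (9 / 10) ^ 7 := by
        rw [← pow_add]; congr 1; omega
      rw [add_mul, one_div_mul_eq_div, h2]
      have h3 : (0 : ℝ) ≤ (9 / 10) ^ (j - 7) * n := by positivity
      norm_num
      linarith

theorem totalSent_le_of_typical {ω : Sample n} (hω : ω ∈ typical P m r) :
    totalSent (P ω) ω ≤ (3 * (41 + 2 * r) * n : ℕ) := by
  refine (hP.totalSent_le ω).trans ?_
  rw [tsum_eq_sum (s := Finset.range (m + r)) fun i hi => by
    rw [unplaced_eq_empty_of_typical hP hω (by simpa using hi)]; simp]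
  have h1 : ((∑ i ∈ Finset.range (m + r), (unplaced (P ω i)).card * numReq n i : ℕ) : ℝ) ≤
      ((41 + 2 * r) * n : ℕ) := by
    push_cast
    calc ∑ i ∈ Finset.range (m + r), ((unplaced (P ω i)).card * numReq n i : ℝ)
        ≤ ∑ i ∈ Finset.range (m + r), requestBound n m i * n :=
          Finset.sum_le_sum fun i _ => mul_numReq_le_requestBound hL hm hP hω i
      _ = (∑ i ∈ Finset.range (m + r), requestBound n m i) * n := (Finset.sum_mul _ _ _).symm
      _ ≤ _ := by
          have := sum_requestBound_le (r := r) hL hm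
          gcongr
  have h2 := Nat.mul_le_mul_left 3 (Nat.cast_le.1 h1)
  rw [← mul_assoc] at h2
  exact_mod_cast h2

theorem ballReceived_le_of_typical {ω : Sample n} (hω : ω ∈ typical P m r) (v : Fin n) :
    ballReceived (P ω) v ≤ ENNReal.ofReal ((11 + r) * Real.logb 2 n) := by
  rw [ballReceived, tsum_eq_sum (s := Finset.range (m + r)) fun i hi => by
    rw [requestsOf_eq_zero_of_typical hP hω (by simpa using hi)]; simp]
  rw [← Nat.cast_sum, ← ENNReal.ofReal_natCast]
  refine ENNReal.ofReal_le_ofReal (le_trans ?_ (hm.sum_numReq_le hL))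
  exact_mod_cast Finset.sum_le_sum fun i _ => by unfold requestsOf; split_ifs <;> simp

end

/-! ### Estimates for large `n` -/

open Filter in
theorem eventually_le_logb (x : ℝ) : ∀ᶠ n : ℕ in atTop, x ≤ Real.logb 2 n :=
  ((Real.tendsto_logb_atTop (by norm_num)).comp tendsto_natCast_atTop_atTop).eventually_ge_atTop x

open Filter in
/-- The error of a round is superpolynomially small. -/
theorem eventually_roundError_le (s : ℝ) : ∀ᶠ n : ℕ in atTop, roundError n ≤ (n : ℝ) ^ (-s) := by
  have h1 : ∀ᶠ x : ℝ in atTop, (50 * Real.logb 2 x ^ 2) ^ 2 ≤ x := by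
    have h := (Real.isLittleO_pow_log_id_atTop (n := 4)).def
      (c := Real.log 2 ^ 4 / 2500) (by have := Real.log_pos one_lt_two; positivity)
    filter_upwards [h, eventually_ge_atTop 0] with x hx hx0
    rw [id, Real.norm_of_nonneg hx0, Real.norm_of_nonneg (by positivity)] at hx
    have h2 : 0 < Real.log 2 ^ 4 := by have := Real.log_pos one_lt_two; positivity
    calc (50 * Real.logb 2 x ^ 2) ^ 2 = 2500 * Real.log x ^ 4 / Real.log 2 ^ 4 := by
          rw [Real.logb]; field_simp; ring
      _ ≤ 2500 * (Real.log 2 ^ 4 / 2500 * x) / Real.log 2 ^ 4 := by gcongr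
      _ = x := by field_simp
  have h2 : ∀ᶠ x : ℝ in atTop, Real.sqrt x ^ (2 * s) * Real.exp (-1 * Real.sqrt x) ≤ 1 :=
    ((tendsto_rpow_mul_exp_neg_mul_atTop_nhds_zero (2 * s) 1 one_pos).comp
      Real.tendsto_sqrt_atTop).eventually_le_const one_pos
  have h3 := tendsto_natCast_atTop_atTop.eventually (h1.and h2)
  filter_upwards [h3, eventually_gt_atTop 0, eventually_le_logb 1] with n hn hn0 hL
  have hn0' : (0 : ℝ) < n := by exact_mod_cast hn0
  have hsq : 0 < Real.sqrt n := Real.sqrt_pos.2 hn0'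
  have h4 : 50 * Real.logb 2 n ^ 2 ≤ Real.sqrt n := Real.le_sqrt_of_sq_le hn.1
  have h5 : Real.sqrt n ≤ n / (50 * Real.logb 2 n ^ 2) := by
    rw [le_div_iff₀ (by positivity)]
    calc Real.sqrt n * (50 * Real.logb 2 n ^ 2) ≤ Real.sqrt n * Real.sqrt n := by gcongr
      _ = n := Real.mul_self_sqrt hn0'.le
  have h6 : Real.sqrt n ^ (2 * s) = (n : ℝ) ^ s := by
    rw [Real.sqrt_eq_rpow, ← Real.rpow_mul hn0'.le]; congr 1; ring
  have h7 := hn.2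
  rw [h6] at h7
  calc roundError n ≤ Real.exp (-1 * Real.sqrt n) :=
        Real.exp_le_exp.2 (by linarith)
    _ ≤ 1 / (n : ℝ) ^ s := by
        rw [le_div_iff₀ (Real.rpow_pos_of_pos hn0' s), mul_comm]; exact h7
    _ = (n : ℝ) ^ (-s) := by rw [Real.rpow_neg hn0'.le, one_div]

theorem mul_rpow_le_of_four_mul_le {x c d M : ℝ} (hx : 1 ≤ x) (hM : 4 * M ≤ x)
    (hd : c + 1 ≤ d) : M * x ^ (-d) ≤ 1 / 4 * (1 / x ^ c) := by
  have hx0 : 0 < x := by linarith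
  calc M * x ^ (-d) ≤ x / 4 * x ^ (-(c + 1)) := by
        gcongr
        linarith
    _ = 1 / 4 * (1 / x ^ c) := by
        rw [Real.rpow_neg hx0.le, Real.rpow_add hx0, Real.rpow_one]
        field_simp

/-- Four rounds with `⌊log n⌋` requests reduce the probability to survive by a factor of `2/n`. -/
theorem survivalBound_add_four_mul_le {n m : ℕ} (hL : 4 ≤ Real.logb 2 n) (hm : IsSaturation n m)
    (s : ℕ) : survivalBound n (m + 4 * s) ≤ (2 / n) ^ s := by
  have hn : (0 : ℝ) < n := by
    rcases Nat.eq_zero_or_pos n with rfl | h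
    · norm_num at hL
    · exact_mod_cast h
  have h1 : ∏ j ∈ Finset.Ico 7 m, ((3 / 4 : ℝ)) ^ numReq n j ≤ 1 :=
    Finset.prod_le_one (fun _ _ => by positivity) fun _ _ => pow_le_one₀ (by norm_num) (by norm_num)
  have h2 : ∏ j ∈ Finset.Ico m (m + 4 * s), ((3 / 4 : ℝ)) ^ numReq n j =
      (((3 / 4) ^ 4) ^ numReq n m) ^ s := by
    rw [Finset.prod_congr rfl fun j hj => by rw [hm.numReq_eq (Finset.mem_Ico.1 hj).1],
      Finset.prod_const, Nat.card_Ico, Nat.add_sub_cancel_left, ← pow_mul, ← pow_mul, ← pow_mul]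
    congr 1; ring
  have h3 : (1 / 2 : ℝ) ^ numReq n m ≤ 2 / n := by
    have h4 : Real.logb 2 n < numReq n m + 1 := by
      rw [← hm.kParam_eq m le_rfl]; exact Nat.lt_floor_add_one _
    have h5 : (n : ℝ) ≤ 2 ^ (numReq n m + 1) := by
      rw [Real.logb_lt_iff_lt_rpow (by norm_num) hn] at h4
      exact_mod_cast h4.le
    rw [one_div, inv_pow, inv_eq_one_div, div_le_div_iff₀ (by positivity) hn, one_mul]
    rwa [pow_succ, mul_comm] at h5
  rw [survivalBound, ← Finset.prod_Ico_consecutive _ hm.seven_le (Nat.le_add_right _ _), h2]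
  calc _ ≤ 1 * (((3 / 4 : ℝ) ^ 4) ^ numReq n m) ^ s := by gcongr
    _ ≤ 1 * ((1 / 2 : ℝ) ^ numReq n m) ^ s := by gcongr; norm_num
    _ ≤ (2 / n) ^ s := by rw [one_mul]; gcongr

theorem law_compl_typical_le {n m : ℕ} [NeZero n] (hL : 4 ≤ Real.logb 2 n) (hm : IsSaturation n m)
    {P : Sample n → ℕ → Placement n} (hP : IsExecution P) (s : ℕ) :
    law n (typical P m (4 * s))ᶜ ≤
      ENNReal.ofReal (11 * n * roundError n + n * (2 / n) ^ s) := by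
  have hsub : (typical P m (4 * s))ᶜ ⊆
      {ω | ∃ j ≤ m, unplacedBound n j < (unplaced (P ω j)).card} ∪
      ⋃ v ∈ (Finset.univ : Finset (Fin n)), {ω | P ω (m + 4 * s) v = none ∧
        ∀ j, 7 ≤ j → j < m + 4 * s → 4 * ((unplaced (P ω j)).card * numReq n j) ≤ n} := by
    intro ω hω
    by_cases hb : ∃ j ≤ m, unplacedBound n j < (unplaced (P ω j)).card
    · exact Or.inl hb
    · push Not at hb
      have hex : ∃ v, P ω (m + 4 * s) v = none := by
        by_contra h
        push Not at h
        exact hω ⟨hb, h⟩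
      obtain ⟨v, hv⟩ := hex
      refine Or.inr (Set.mem_biUnion (Finset.mem_coe.2 (Finset.mem_univ v)) ⟨hv, fun j hj _ => ?_⟩)
      exact four_mul_le_of_forall_le_unplacedBound hL hm hP hb hj
  have hε := roundError_nonneg n
  have hm' : (m : ℝ) ≤ 11 * n := by
    have := hm.le_logb hL
    have := logb_two_natCast_le n
    linarith
  refine (measure_mono hsub).trans ((measure_union_le _ _).trans ?_)
  rw [ENNReal.ofReal_add (by positivity) (by positivity)]
  refine add_le_add ?_ ?_
  · refine (hP.law_exists_unplacedBound_lt_le hL m).trans ?_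
    rw [← ENNReal.ofReal_natCast, ← ENNReal.ofReal_mul (by positivity)]
    refine ENNReal.ofReal_le_ofReal ?_
    gcongr
  · refine (measure_biUnion_finset_le _ _).trans ?_
    refine (Finset.sum_le_card_nsmul _ _ (ENNReal.ofReal ((2 / n) ^ s)) fun v _ => ?_).trans ?_
    · exact (hP.law_unplaced_of_few_requests_le v _).trans
        (ENNReal.ofReal_le_ofReal (survivalBound_add_four_mul_le hL hm s))
    · rw [Finset.card_univ, Fintype.card_fin, nsmul_eq_mul, ENNReal.ofReal_mul (by positivity),
        ENNReal.ofReal_natCast]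

open Filter in
theorem eventually_typical_error_le (c : ℝ) {s : ℕ} (hs : c + 3 ≤ s) : ∀ᶠ n : ℕ in atTop,
    11 * n * roundError n + n * (2 / n) ^ s ≤ 1 / 2 * (1 / (n : ℝ) ^ c) := by
  filter_upwards [eventually_roundError_le (c + 2), eventually_ge_atTop 44,
    eventually_ge_atTop (4 * 2 ^ s)] with n h1 h2 h3
  have h2' : (44 : ℝ) ≤ n := by exact_mod_cast h2
  have hn : (0 : ℝ) < n := by linarith
  have h3' : 4 * (2 : ℝ) ^ s ≤ n := by exact_mod_cast h3
  have h4 : 11 * n * roundError n ≤ 11 * (n : ℝ) ^ (-(c + 1)) := by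
    calc 11 * n * roundError n ≤ 11 * n * (n : ℝ) ^ (-(c + 2)) := by gcongr
      _ = 11 * ((n : ℝ) ^ (1 : ℝ) * (n : ℝ) ^ (-(c + 2))) := by rw [Real.rpow_one]; ring
      _ = 11 * (n : ℝ) ^ (-(c + 1)) := by rw [← Real.rpow_add hn]; congr 2; ring
  have h5 : n * (2 / n) ^ s = (2 : ℝ) ^ s * (n : ℝ) ^ (-(s - 1 : ℝ)) := by
    rw [div_pow, neg_sub, Real.rpow_sub hn, Real.rpow_one, Real.rpow_natCast]; ring
  have h6 := mul_rpow_le_of_four_mul_le (x := n) (c := c) (M := 11) (by linarith) (by linarith)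
    le_rfl
  have h7 := mul_rpow_le_of_four_mul_le (x := n) (c := c) (d := s - 1) (M := 2 ^ s) (by linarith) h3'
    (by linarith)
  linarith

/-! ### Guarantees with high probability -/

theorem one_sub_le_law_real {n : ℕ} [NeZero n] {A B : Set (Sample n)} {d : ℝ} (hd : 0 ≤ d)
    (hB : law n B ≤ ENNReal.ofReal d) (hAB : Bᶜ ⊆ A) : 1 - d ≤ (law n).real A := by
  have h1 : (law n).real Set.univ ≤ (law n).real A + (law n).real B :=
    (measureReal_mono fun ω _ => (em (ω ∈ B)).symm.imp (fun h => hAB h) id).trans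
      (measureReal_union_le A B)
  rw [probReal_univ] at h1
  have h2 : (law n).real B ≤ d := ENNReal.toReal_le_of_le_ofReal hd hB
  linarith

/-- The tail of the number of requests that a bin receives in typical executions. -/
theorem law_typical_lt_sum_requestsAt_le {n m r : ℕ} [NeZero n] (hL : 4 ≤ Real.logb 2 n)
    (hm : IsSaturation n m) {P : Sample n → ℕ → Placement n} (hP : IsExecution P) (w : Fin n)
    {a : ℝ} (ha : 1 ≤ a) (x : ℝ) :
    law n {ω | ω ∈ typical P m r ∧
      x < (∑ i ∈ Finset.range (m + r), requestsAt (P ω) ω w i : ℕ)} ≤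
      ENNReal.ofReal (Real.exp ((a - 1) * (41 + 2 * r)) / a ^ x) := by
  set A := {ω | ∀ j < m + r, ((unplaced (P ω j)).card * numReq n j : ℝ) ≤
    requestBound n m j * n} with hA
  have hmeasA : MeasurableSet A := measurableSet_of_adapted (m + r) fun ω ω' h h1 j hj => by
    rw [← hP.adapted j ω ω' fun k hk => h k (by omega)]
    exact h1 j hj
  have hmeas : Measurable fun ω => ∑ i ∈ Finset.range (m + r), requestsAt (P ω) ω w i :=
    Finset.measurable_fun_sum _ fun j _ => hP.measurable_requestsAt w j
  have h1 := measure_lt_natCast_le (μ := (law n).restrict A) hmeas ha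
    (M := Real.exp ((a - 1) * (41 + 2 * r))) ?_ x
  · refine le_trans ?_ h1
    rw [Measure.restrict_apply' hmeasA]
    refine measure_mono ?_
    rintro ω ⟨h2, h3⟩
    exact ⟨h3, fun j _ => mul_numReq_le_requestBound hL hm hP h2 j⟩
  · rw [← lintegral_indicator hmeasA]
    refine (hP.lintegral_pow_sum_requestsAt_le w ha (m + r)).trans (ENNReal.ofReal_le_ofReal ?_)
    refine Real.exp_le_exp.2 (mul_le_mul_of_nonneg_left (sum_requestBound_le hL hm) (by linarith))

open Filter in
/-- With `x = 2 s log n / log log n`, the power `(√(log n))^x` equals `n^s`. -/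
theorem eventually_bin_error_le (c C : ℝ) {s : ℕ} (hs : c + 3 ≤ s) : ∀ᶠ n : ℕ in atTop,
    n * (Real.exp ((Real.sqrt (Real.logb 2 n) - 1) * C) /
      Real.sqrt (Real.logb 2 n) ^ (2 * s * (Real.logb 2 n / Real.logb 2 (Real.logb 2 n)))) ≤
      1 / 4 * (1 / (n : ℝ) ^ c) := by
  filter_upwards [eventually_le_logb 4, eventually_le_logb (4 * C ^ 2), eventually_ge_atTop 4]
    with n hL hC hn
  have hn4 : (4 : ℝ) ≤ n := by exact_mod_cast hn
  have hn0 : (0 : ℝ) < n := by linarith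
  set L := Real.logb 2 n with hLdef
  have hL0 : 0 < L := by linarith
  have hsq : 0 < Real.sqrt L := Real.sqrt_pos.2 hL0
  have hlog2 : 0 < Real.log 2 := Real.log_pos one_lt_two
  have hlogL : 0 < Real.log L := Real.log_pos (by linarith)
  have hLlog : L * Real.log 2 = Real.log n := by rw [hLdef, Real.logb]; field_simp
  have h1 : Real.sqrt L ^ (2 * s * (L / Real.logb 2 L)) = (n : ℝ) ^ (s : ℝ) := by
    rw [Real.rpow_def_of_pos hsq, Real.rpow_def_of_pos hn0, Real.log_sqrt hL0.le, ← hLlog]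
    congr 1
    rw [Real.logb]
    field_simp
  have h2 : Real.exp ((Real.sqrt L - 1) * C) ≤ n := by
    rw [← Real.le_log_iff_exp_le hn0, ← hLlog]
    have h3 : 2 * |C| ≤ Real.sqrt L := by
      refine Real.le_sqrt_of_sq_le ?_
      rw [mul_pow, sq_abs]
      linarith
    have h4 : (1 / 2 : ℝ) ≤ Real.log 2 := by linarith [Real.log_two_gt_d9]
    have h5 : (1 : ℝ) ≤ Real.sqrt L := by
      rw [Real.one_le_sqrt]; linarith
    calc (Real.sqrt L - 1) * C ≤ (Real.sqrt L - 1) * |C| :=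
          mul_le_mul_of_nonneg_left (le_abs_self C) (by linarith)
      _ ≤ Real.sqrt L * |C| := mul_le_mul_of_nonneg_right (by linarith) (abs_nonneg C)
      _ ≤ Real.sqrt L * (Real.sqrt L / 2) := by gcongr; linarith
      _ = L * (1 / 2) := by
          rw [mul_div_assoc', Real.mul_self_sqrt hL0.le]; ring
      _ ≤ L * Real.log 2 := by gcongr
  rw [h1]
  calc n * (Real.exp ((Real.sqrt L - 1) * C) / (n : ℝ) ^ (s : ℝ))
      ≤ n * (n / (n : ℝ) ^ (s : ℝ)) := by gcongr
    _ = 1 * (n : ℝ) ^ (-(s - 2 : ℝ)) := by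
        rw [neg_sub, Real.rpow_sub hn0, Real.rpow_ofNat]; ring
    _ ≤ _ := mul_rpow_le_of_four_mul_le (by linarith) (by linarith) (by linarith)

section Family

variable {S : ℕ → Type} {R : (n : ℕ) → S n → Sample n → ℕ → Placement n}
  (hR : ∀ n s, IsExecution (R n s))
include hR

/-- To obtain a guarantee with high probability, it suffices to consider typical executions. -/
theorem whp_of_typical {A : (C : ℕ) → (n : ℕ) → S n → Set (Sample n)}
    (h : ∀ r : ℕ, ∃ C n₀ : ℕ, ∀ (n : ℕ) [NeZero n], n₀ ≤ n → 4 ≤ Real.logb 2 n →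
      ∀ m, IsSaturation n m → ∀ s, typical (R n s) m r ⊆ A C n s) : Whp A := by
  intro c hc
  obtain ⟨s, hs⟩ := exists_nat_ge (c + 3)
  obtain ⟨C, n₀, hCn⟩ := h (4 * s)
  obtain ⟨n₁, hn₁⟩ := Filter.eventually_atTop.1
    ((eventually_le_logb 4).and (eventually_typical_error_le c hs))
  refine ⟨C, max n₀ n₁, fun n _ hn x => ?_⟩
  obtain ⟨hL, herr⟩ := hn₁ n ((le_max_right _ _).trans hn)
  obtain ⟨m, h1, h2, h3, h4⟩ := exists_saturation hL
  have hm : IsSaturation n m := ⟨h1, h2, h3, h4⟩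
  have hpos : 0 ≤ 1 / (n : ℝ) ^ c := by positivity
  refine one_sub_le_law_real hpos ((law_compl_typical_le hL hm (hR n x) s).trans
    (ENNReal.ofReal_le_ofReal (herr.trans (by linarith)))) ?_
  rw [compl_compl]
  exact hCn n ((le_max_left _ _).trans hn) hL m hm x

theorem whp_bins : Whp (S := S) fun C n s => {ω | ∀ w,
    binSent (R n s ω) ω w ≤ ENNReal.ofReal (C * (Real.logb 2 n / Real.logb 2 (Real.logb 2 n))) ∧
      binReceived (R n s ω) ω w ≤
        ENNReal.ofReal (C * (Real.logb 2 n / Real.logb 2 (Real.logb 2 n)))} := by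
  intro c hc
  obtain ⟨s, hs⟩ := exists_nat_ge (c + 3)
  obtain ⟨n₁, hn₁⟩ := Filter.eventually_atTop.1
    (((eventually_le_logb 4).and (eventually_typical_error_le c hs)).and
      (eventually_bin_error_le c (41 + 2 * (4 * s : ℕ)) hs))
  refine ⟨4 * s, n₁, fun n _ hn x => ?_⟩
  obtain ⟨⟨hL, herr⟩, herr'⟩ := hn₁ n hn
  obtain ⟨m, h1, h2, h3, h4⟩ := exists_saturation hL
  have hm : IsSaturation n m := ⟨h1, h2, h3, h4⟩
  have hpos : 0 ≤ 1 / (n : ℝ) ^ c := by positivity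
  set ℓ := Real.logb 2 n / Real.logb 2 (Real.logb 2 n) with hℓ
  have hℓ0 : 0 ≤ ℓ := div_nonneg (by linarith) (Real.logb_nonneg (by norm_num) (by linarith))
  have ha : 1 ≤ Real.sqrt (Real.logb 2 n) := by rw [Real.one_le_sqrt]; linarith
  refine one_sub_le_law_real hpos (B := (typical (R n x) m (4 * s))ᶜ ∪
    ⋃ w ∈ (Finset.univ : Finset (Fin n)), {ω | ω ∈ typical (R n x) m (4 * s) ∧
      2 * s * ℓ < (∑ i ∈ Finset.range (m + 4 * s), requestsAt (R n x ω) ω w i : ℕ)}) ?_ ?_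
  · refine (measure_union_le _ _).trans (le_trans (add_le_add
      ((law_compl_typical_le hL hm (hR n x) s).trans (ENNReal.ofReal_le_ofReal herr))
      ((measure_biUnion_finset_le _ _).trans ((Finset.sum_le_card_nsmul _ _ _ fun w _ =>
        law_typical_lt_sum_requestsAt_le hL hm (hR n x) w ha (2 * s * ℓ)).trans ?_)))
      (b := ENNReal.ofReal (1 / 2 * (1 / (n : ℝ) ^ c)) +
        ENNReal.ofReal (1 / 4 * (1 / (n : ℝ) ^ c))) ?_)
    · rw [Finset.card_univ, Fintype.card_fin, nsmul_eq_mul, ← ENNReal.ofReal_natCast,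
        ← ENNReal.ofReal_mul (Nat.cast_nonneg _)]
      exact ENNReal.ofReal_le_ofReal herr'
    · rw [← ENNReal.ofReal_add (by positivity) (by positivity)]
      exact ENNReal.ofReal_le_ofReal (by linarith)
  · intro ω hω w
    simp only [Set.compl_union, compl_compl, Set.mem_inter_iff, Set.mem_compl_iff, Set.mem_iUnion,
      not_exists] at hω
    have hS : ((∑ i ∈ Finset.range (m + 4 * s), requestsAt (R n x ω) ω w i : ℕ) : ℝ) ≤
        2 * s * ℓ := by
      by_contra h
      exact hω.2 w (Finset.mem_univ w) ⟨hω.1, not_le.1 h⟩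
    have hsent : binSent (R n x ω) ω w ≤ ENNReal.ofReal (2 * s * ℓ) := by
      rw [binSent_eq_of_typical (hR n x) hω.1, ← ENNReal.ofReal_natCast]
      exact ENNReal.ofReal_le_ofReal hS
    have hs0 : 0 ≤ s * ℓ := by positivity
    constructor
    · refine hsent.trans (ENNReal.ofReal_le_ofReal ?_)
      push_cast
      linarith
    · refine ((hR n x).binReceived_le ω w).trans ((mul_le_mul_right hsent 2).trans ?_)
      rw [← ENNReal.ofReal_ofNat, ← ENNReal.ofReal_mul (by norm_num)]
      refine ENNReal.ofReal_le_ofReal ?_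
      push_cast
      linarith

end Family

/-! ### Expectations -/

/-- The requests that a ball is expected to send decrease geometrically: the parameter grows by
`e^{⌊k⌋/10}`, but the ball survives with probability at most `(3/4)^⌊k⌋`. -/
theorem kParam_mul_survivalBound_le {n : ℕ} (hL : 4 ≤ Real.logb 2 n) (i : ℕ) :
    kParam n i * survivalBound n i ≤ 8 * (83 / 100) ^ i := by
  have hsmall : ∀ i ≤ 7, kParam n i * survivalBound n i ≤ 8 * (83 / 100) ^ i := by
    intro i hi
    have h1 : survivalBound n i = 1 := by rw [survivalBound, Finset.Ico_eq_empty (by omega)]; simp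
    have h2 : (83 / 100 : ℝ) ^ 7 ≤ (83 / 100) ^ i :=
      pow_le_pow_of_le_one (by norm_num) (by norm_num) hi
    have h3 := (kParam_monotone hL hi).trans (kParam_seven_le hL)
    rw [h1, mul_one]
    norm_num at h2
    linarith
  induction i with
  | zero => exact hsmall 0 (by omega)
  | succ i ih =>
    rcases le_or_gt (i + 1) 7 with hi | hi
    · exact hsmall (i + 1) hi
    · have hs0 : 0 ≤ survivalBound n i := Finset.prod_nonneg fun _ _ => by positivity
      have hk0 : 0 ≤ kParam n i := zero_le_one.trans (one_le_kParam hL i)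
      have h1 : survivalBound n (i + 1) = survivalBound n i * (3 / 4) ^ numReq n i :=
        Finset.prod_Ico_succ_top (by omega) _
      have h2 : (3 / 4) ^ numReq n i * Real.exp ((numReq n i : ℝ) / 10) ≤ 83 / 100 :=
        (three_quarters_pow_mul_exp_le _).trans (pow_le_of_le_one (by norm_num) (by norm_num)
          (Nat.pos_iff_ne_zero.1 (one_le_numReq hL i)))
      calc kParam n (i + 1) * survivalBound n (i + 1)
          ≤ kParam n i * Real.exp ((numReq n i : ℝ) / 10) *
            (survivalBound n i * (3 / 4) ^ numReq n i) := by
            rw [h1]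
            exact mul_le_mul_of_nonneg_right (kParam_succ_le i) (by positivity)
        _ = kParam n i * survivalBound n i *
            ((3 / 4) ^ numReq n i * Real.exp ((numReq n i : ℝ) / 10)) := by ring
        _ ≤ 8 * (83 / 100) ^ i * (83 / 100) := by gcongr
        _ = 8 * (83 / 100) ^ (i + 1) := by rw [pow_succ]; ring

theorem tsum_add_two_mul_geometric_le {x : ℝ} (h0 : 0 ≤ x) (h1 : x < 1) :
    Summable (fun i : ℕ => ((i : ℝ) + 2) * x ^ i) ∧
      ∑' i : ℕ, ((i : ℝ) + 2) * x ^ i ≤ 3 / (1 - x) ^ 2 := by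
  have hx : ‖x‖ < 1 := by rwa [Real.norm_of_nonneg h0]
  have h2 := (hasSum_coe_mul_geometric_of_norm_lt_one hx).add
    ((hasSum_geometric_of_lt_one h0 h1).mul_left 2)
  have h3 : (fun i : ℕ => ((i : ℝ) + 2) * x ^ i) = fun i : ℕ => (i : ℝ) * x ^ i + 2 * x ^ i := by
    funext i; ring
  rw [h3]
  refine ⟨h2.summable, ?_⟩
  rw [h2.tsum_eq]
  have h4 : 0 < 1 - x := by linarith
  rw [← sub_nonneg]
  have h5 : 3 / (1 - x) ^ 2 - (x / (1 - x) ^ 2 + 2 * (1 - x)⁻¹) = (1 + x) / (1 - x) ^ 2 := by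
    field_simp; ring
  rw [h5]
  positivity

theorem messageSize_le (i : ℕ) : messageSize i ≤ i + 2 := by
  have h : Nat.size (i + 1) ≤ i + 1 := Nat.size_le.2 Nat.lt_two_pow_self
  unfold messageSize
  omega

open Filter in
theorem eventually_mul_sqrt_roundError_le : ∀ᶠ n : ℕ in atTop,
    (n : ℝ) * (n + 1) ^ 2 * (96 * Real.sqrt (33 * n * roundError n)) ≤ 1 := by
  filter_upwards [eventually_roundError_le (11 : ℕ), eventually_ge_atTop 48] with n hn h48
  have hn48 : (48 : ℝ) ≤ n := by exact_mod_cast h48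
  have hn0 : (0 : ℝ) < n := by linarith
  rw [Real.rpow_neg hn0.le, Real.rpow_natCast] at hn
  have hsq : Real.sqrt (33 * n * roundError n) ≤ 6 * ((n : ℝ) ^ 5)⁻¹ := by
    refine Real.sqrt_le_iff.2 ⟨by positivity, ?_⟩
    have hε := roundError_nonneg n
    calc 33 * n * roundError n ≤ 36 * n * ((n : ℝ) ^ 11)⁻¹ := by
          gcongr; norm_num
      _ = (6 * ((n : ℝ) ^ 5)⁻¹) ^ 2 := by field_simp; norm_num
  calc (n : ℝ) * (n + 1) ^ 2 * (96 * Real.sqrt (33 * n * roundError n))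
      ≤ n * (n + n) ^ 2 * (96 * (6 * ((n : ℝ) ^ 5)⁻¹)) := by gcongr; linarith
    _ = 2304 / (n : ℝ) ^ 2 := by field_simp; norm_num
    _ ≤ 1 := by rw [div_le_one (by positivity)]; nlinarith

theorem ballSent_le_ballBits {n : ℕ} (P : Sample n → ℕ → Placement n) (ω : Sample n) (v : Fin n) :
    ballSent (P ω) v ≤ ballBits (P ω) v := by
  refine ENNReal.tsum_le_tsum fun i => ?_
  exact_mod_cast Nat.le_mul_of_pos_right _ (Nat.succ_pos _)

theorem ballReceived_le_ballSent {n : ℕ} (P : Sample n → ℕ → Placement n) (ω : Sample n)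
    (v : Fin n) :
    ballReceived (P ω) v ≤ ballSent (P ω) v :=
  ENNReal.tsum_le_tsum fun i => by exact_mod_cast Nat.le_add_right _ _

namespace IsExecution

variable {n : ℕ} [NeZero n] {P : Sample n → ℕ → Placement n} (hP : IsExecution P)
include hP

/-- A ball survives either rounds with few requests, or an atypical execution that is still
running. The probability of the latter is at most the geometric mean of the bounds for the two
conditions. -/
theorem law_eq_none_le (hL : 4 ≤ Real.logb 2 n) (v : Fin n) (i : ℕ) :
    law n {ω | P ω i v = none} ≤ ENNReal.ofReal (survivalBound n i +
      Real.sqrt (33 * n * roundError n) * (1 - 1 / (4 * (n + 1))) ^ i) := by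
  obtain ⟨m, h1, h2, h3, h4⟩ := exists_saturation hL
  have hm : IsSaturation n m := ⟨h1, h2, h3, h4⟩
  have hε := roundError_nonneg n
  have hn : (1 : ℝ) ≤ n := by exact_mod_cast Nat.one_le_iff_ne_zero.2 (NeZero.ne n)
  have hx : 1 / (2 * ((n : ℝ) + 1)) ≤ 1 := by rw [div_le_one (by positivity)]; linarith
  have hx' : 1 / (4 * ((n : ℝ) + 1)) ≤ 1 := by rw [div_le_one (by positivity)]; linarith
  set B := {ω | ∃ j ≤ m, unplacedBound n j < (unplaced (P ω j)).card} with hB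
  have hsub : {ω | P ω i v = none} ⊆
      {ω | P ω i v = none ∧ ∀ j, 7 ≤ j → j < i →
        4 * ((unplaced (P ω j)).card * numReq n j) ≤ n} ∪
      (B ∩ {ω | (unplaced (P ω i)).Nonempty}) := by
    intro ω hω
    by_cases hb : ω ∈ B
    · exact Or.inr ⟨hb, v, by simpa using hω⟩
    · have hb' : ∀ j ≤ m, ((unplaced (P ω j)).card : ℝ) ≤ unplacedBound n j := by
        intro j hj
        by_contra h
        exact hb ⟨j, hj, not_le.1 h⟩
      exact Or.inl ⟨hω, fun j hj _ => four_mul_le_of_forall_le_unplacedBound hL hm hP hb' hj⟩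
  have hs0 : 0 ≤ survivalBound n i := Finset.prod_nonneg fun _ _ => by positivity
  have hl0 : 0 ≤ 1 - 1 / (4 * ((n : ℝ) + 1)) := by linarith
  refine (measure_mono hsub).trans ((measure_union_le _ _).trans ?_)
  rw [ENNReal.ofReal_add hs0 (by positivity)]
  refine add_le_add (hP.law_unplaced_of_few_requests_le v i) ?_
  have hp : (law n).real (B ∩ {ω | (unplaced (P ω i)).Nonempty}) ≤ 11 * n * roundError n := by
    refine ENNReal.toReal_le_of_le_ofReal (by positivity) ((measure_mono Set.inter_subset_left).trans
      ((hP.law_exists_unplacedBound_lt_le hL m).trans ?_))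
    rw [← ENNReal.ofReal_natCast, ← ENNReal.ofReal_mul (by positivity)]
    refine ENNReal.ofReal_le_ofReal ?_
    have := hm.le_logb hL
    have := logb_two_natCast_le n
    gcongr
    linarith
  have hq : (law n).real (B ∩ {ω | (unplaced (P ω i)).Nonempty}) ≤
      3 * (1 - 1 / (2 * (n + 1))) ^ i :=
    ENNReal.toReal_le_of_le_ofReal
      (mul_nonneg (by norm_num) (pow_nonneg (by linarith) i))
      ((measure_mono Set.inter_subset_right).trans (hP.law_unplaced_nonempty_le hL i))
  rw [← ofReal_measureReal]
  refine ENNReal.ofReal_le_ofReal ?_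
  refine le_of_sq_le_sq ?_ (by positivity)
  have hsq : 1 - 1 / (2 * ((n : ℝ) + 1)) ≤ (1 - 1 / (4 * ((n : ℝ) + 1))) ^ 2 := by
    have h5 : 1 / (2 * ((n : ℝ) + 1)) = 2 * (1 / (4 * ((n : ℝ) + 1))) := by field_simp; norm_num
    rw [h5]
    nlinarith [sq_nonneg (1 / (4 * ((n : ℝ) + 1)))]
  calc (law n).real (B ∩ {ω | (unplaced (P ω i)).Nonempty}) ^ 2
      ≤ (11 * n * roundError n) * (3 * (1 - 1 / (2 * (n + 1))) ^ i) := by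
        rw [sq]
        exact mul_le_mul hp hq measureReal_nonneg (by positivity)
    _ = 33 * n * roundError n * (1 - 1 / (2 * (n + 1))) ^ i := by ring
    _ ≤ 33 * n * roundError n * ((1 - 1 / (4 * ((n : ℝ) + 1))) ^ 2) ^ i := by
        gcongr
    _ = _ := by
        rw [mul_pow, Real.sq_sqrt (by positivity), ← pow_mul, ← pow_mul, mul_comm 2]

/-- `1662` exceeds `16 * 3 / (1 - 83/100)^2 + 1`, the contributions of the two terms of
`law_eq_none_le`. -/
theorem lintegral_ballBits_le (hL : 4 ≤ Real.logb 2 n)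
    (hsmall : (n : ℝ) * (n + 1) ^ 2 * (96 * Real.sqrt (33 * n * roundError n)) ≤ 1) (v : Fin n) :
    ∫⁻ ω, ballBits (P ω) v ∂law n ≤ (1662 : ℕ) := by
  have hn : (1 : ℝ) ≤ n := by exact_mod_cast Nat.one_le_iff_ne_zero.2 (NeZero.ne n)
  have hx' : 1 / (4 * ((n : ℝ) + 1)) ≤ 1 := by rw [div_le_one (by positivity)]; linarith
  set l : ℝ := 1 - 1 / (4 * (n + 1)) with hl
  have hl0 : 0 ≤ l := by linarith
  have hl1 : l < 1 := by
    have : 0 < 1 / (4 * ((n : ℝ) + 1)) := by positivity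
    linarith
  set e := Real.sqrt (33 * n * roundError n) with he
  have hmeas : ∀ i, Measurable fun ω =>
      (((requestsOf (P ω) v i + noticesOf (P ω) v i) * messageSize i : ℕ) : ℝ≥0∞) := fun i =>
    measurable_of_adapted _ (i + 2) fun ω ω' h => by
      unfold requestsOf noticesOf
      rw [hP.adapted i ω ω' fun k hk => h k (by omega),
        hP.adapted (i + 1) ω ω' fun k hk => h k (by omega)]
  have hround : ∀ i, ∫⁻ ω, (((requestsOf (P ω) v i + noticesOf (P ω) v i) * messageSize i : ℕ) :
      ℝ≥0∞) ∂law n ≤ ENNReal.ofReal (16 * ((i + 2) * (83 / 100) ^ i) +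
        2 * n * e * ((i + 2) * l ^ i)) := by
    intro i
    have hset : MeasurableSet {ω | P ω i v = none} :=
      measurableSet_of_adapted i fun ω ω' h h1 => by rwa [Set.mem_ofPred_eq, ← hP.adapted i ω ω' h]
    have hpt : ∀ ω, (((requestsOf (P ω) v i + noticesOf (P ω) v i) * messageSize i : ℕ) : ℝ≥0∞) ≤
        {ω | P ω i v = none}.indicator (fun _ => ((2 * (i + 2) * numReq n i : ℕ) : ℝ≥0∞)) ω := by
      intro ω
      by_cases hω : P ω i v = none
      · rw [Set.indicator_of_mem (by exact hω)]
        have h1 : requestsOf (P ω) v i = numReq n i := if_pos hω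
        have h2 := hP.noticesOf_le_requestsOf ω v i
        have h3 : (requestsOf (P ω) v i + noticesOf (P ω) v i) * messageSize i ≤
            (2 * numReq n i) * (i + 2) := Nat.mul_le_mul (by omega) (messageSize_le i)
        exact_mod_cast h3.trans_eq (by ring)
      · have h1 : requestsOf (P ω) v i = 0 := if_neg hω
        have h2 := hP.noticesOf_le_requestsOf ω v i
        rw [h1, Nat.le_zero.1 (h2.trans_eq h1)]
        simp
    refine (lintegral_mono hpt).trans ?_
    rw [lintegral_indicator_const hset]
    refine (mul_le_mul_right (hP.law_eq_none_le hL v i) _).trans ?_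
    rw [← ENNReal.ofReal_natCast, ← ENNReal.ofReal_mul (Nat.cast_nonneg _)]
    refine ENNReal.ofReal_le_ofReal ?_
    have hs0 : 0 ≤ survivalBound n i := Finset.prod_nonneg fun _ _ => by positivity
    have h1 := kParam_mul_survivalBound_le hL i
    have h2 := numReq_le_kParam hL i
    have h3 := (numReq_le_logb hL i).trans (logb_two_natCast_le n)
    have he0 : 0 ≤ e := Real.sqrt_nonneg _
    have h4 : (numReq n i : ℝ) * survivalBound n i ≤ 8 * (83 / 100) ^ i :=
      (mul_le_mul_of_nonneg_right h2 hs0).trans h1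
    calc ((2 * (i + 2) * numReq n i : ℕ) : ℝ) * (survivalBound n i + e * l ^ i)
        = 2 * (i + 2) * (numReq n i * survivalBound n i) +
          2 * (i + 2) * (numReq n i * (e * l ^ i)) := by push_cast; ring
      _ ≤ 2 * (i + 2) * (8 * (83 / 100) ^ i) + 2 * (i + 2) * (n * (e * l ^ i)) := by gcongr
      _ = _ := by ring
  simp only [ballBits]
  rw [lintegral_tsum fun i => (hmeas i).aemeasurable]
  refine (ENNReal.tsum_le_tsum hround).trans ?_
  have he0 : 0 ≤ e := Real.sqrt_nonneg _
  obtain ⟨hs1, hb1⟩ := tsum_add_two_mul_geometric_le (x := 83 / 100) (by norm_num) (by norm_num)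
  obtain ⟨hs2, hb2⟩ := tsum_add_two_mul_geometric_le hl0 hl1
  rw [← ENNReal.ofReal_tsum_of_nonneg (fun i => by positivity)
    ((hs1.mul_left 16).add (hs2.mul_left (2 * n * e))), ← ENNReal.ofReal_natCast]
  refine ENNReal.ofReal_le_ofReal ?_
  rw [(hs1.mul_left 16).tsum_add (hs2.mul_left (2 * n * e)), tsum_mul_left, tsum_mul_left]
  have h1l : 3 / (1 - l) ^ 2 = 48 * ((n : ℝ) + 1) ^ 2 := by
    rw [hl, sub_sub_cancel]; field_simp; norm_num
  have h5 : 2 * n * e * ∑' i : ℕ, ((i : ℝ) + 2) * l ^ i ≤ 1 := by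
    calc 2 * n * e * ∑' i : ℕ, ((i : ℝ) + 2) * l ^ i ≤ 2 * n * e * (3 / (1 - l) ^ 2) := by gcongr
      _ = n * (n + 1) ^ 2 * (96 * e) := by rw [h1l]; ring
      _ ≤ 1 := hsmall
  norm_num at hb1 ⊢
  linarith

/-- Each request reaches a given bin with probability `1/n`, hence a bin expects as many requests
as a ball sends on average. -/
theorem lintegral_binSent_le {C : ℕ}
    (hC : ∀ v, ∫⁻ ω, ballReceived (P ω) v ∂law n ≤ C) (w : Fin n) :
    ∫⁻ ω, binSent (P ω) ω w ∂law n ≤ C := by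
  have hmeas : ∀ v i, Measurable fun ω => (requestsOf (P ω) v i : ℝ≥0∞) := fun v i =>
    measurable_of_adapted _ i fun ω ω' h => by
      unfold requestsOf
      rw [hP.adapted i ω ω' h]
  have hmeas' : ∀ i, Measurable fun ω => (requestsAt (P ω) ω w i : ℝ≥0∞) := fun i =>
    (measurable_of_countable fun k : ℕ => (k : ℝ≥0∞)).comp (hP.measurable_requestsAt w i)
  simp only [binSent]
  rw [lintegral_tsum fun i => (hmeas' i).aemeasurable]
  have h1 : ∀ i, ∫⁻ ω, (requestsAt (P ω) ω w i : ℝ≥0∞) ∂law n =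
      (∑ v, ∫⁻ ω, (requestsOf (P ω) v i : ℝ≥0∞) ∂law n) * (n : ℝ≥0∞)⁻¹ := by
    intro i
    rw [hP.lintegral_requestsAt w i, lintegral_mul_const _
      (hP.measurable_comp i fun Q => (((unplaced Q).card * numReq n i : ℕ) : ℝ≥0∞)),
      ← lintegral_finsetSum _ fun v _ => hmeas v i]
    congr 1
    refine lintegral_congr fun ω => ?_
    exact_mod_cast (sum_requestsOf P ω i).symm
  rw [tsum_congr h1, ENNReal.tsum_mul_right, Summable.tsum_finsetSum fun _ _ => ENNReal.summable]
  have h2 : ∀ v, ∑' i, ∫⁻ ω, (requestsOf (P ω) v i : ℝ≥0∞) ∂law n ≤ C := fun v => by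
    rw [← lintegral_tsum fun i => (hmeas v i).aemeasurable]
    exact hC v
  refine (mul_le_mul_left (Finset.sum_le_card_nsmul _ _ _ fun v _ => h2 v) _).trans_eq ?_
  rw [Finset.card_univ, Fintype.card_fin, nsmul_eq_mul, mul_comm, ← mul_assoc,
    ENNReal.inv_mul_cancel (by simp [NeZero.ne n]) (by simp), one_mul]

end IsExecution

/-! ### All guarantees -/

theorem messageSize_le_mul_logb_logStar {n r i : ℕ} (hL : 4 ≤ Real.logb 2 n)
    (hi : i < logStar n + 25 + r) :
    (messageSize i : ℝ) ≤ (29 + r : ℕ) * Real.logb 2 (logStar n) := by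
  have hn : 2 < n := by
    by_contra h
    have h1 := logb_two_natCast_le n
    have h2 : (n : ℝ) ≤ 2 := by exact_mod_cast not_lt.1 h
    linarith
  have hℓ : 2 ≤ logStar n := by
    have hspec : n ≤ tower (logStar n) := Nat.find_spec (p := fun t => n ≤ tower t) _
    by_contra h
    have : logStar n = 0 ∨ logStar n = 1 := by omega
    rcases this with h | h <;> rw [h] at hspec <;> simp [tower] at hspec <;> omega
  set ℓ := logStar n with hℓ_def
  have h1 : Nat.size (i + 1) ≤ Nat.size ℓ + (26 + r) := by
    refine Nat.size_le.2 ?_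
    calc i + 1 ≤ ℓ * (26 + r) := by nlinarith
      _ < 2 ^ Nat.size ℓ * 2 ^ (26 + r) :=
        Nat.mul_lt_mul'' (Nat.lt_size_self ℓ) Nat.lt_two_pow_self
      _ = _ := (pow_add _ _ _).symm
  have hlog1 : 1 ≤ Real.logb 2 ℓ := by
    rw [Real.le_logb_iff_rpow_le (by norm_num) (by positivity), Real.rpow_one]
    exact_mod_cast hℓ
  have h2 : (Nat.size ℓ : ℝ) ≤ Real.logb 2 ℓ + 1 := by
    obtain ⟨k, hk⟩ : ∃ k, Nat.size ℓ = k + 1 :=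
      Nat.exists_eq_succ_of_ne_zero (Nat.size_pos.2 (by omega)).ne'
    have h3 : 2 ^ k ≤ ℓ := Nat.lt_size.1 (by omega)
    have h4 : (k : ℝ) ≤ Real.logb 2 ℓ := by
      rw [Real.le_logb_iff_rpow_le (by norm_num) (by positivity), Real.rpow_natCast]
      exact_mod_cast h3
    rw [hk]; push_cast; linarith
  have h5 : (messageSize i : ℝ) ≤ Nat.size ℓ + (26 + r) + 1 := by
    unfold messageSize
    exact_mod_cast Nat.add_le_add_right h1 1
  have hr : (0 : ℝ) ≤ r := Nat.cast_nonneg r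
  push_cast
  nlinarith

section Family

variable {S : ℕ → Type} {R : (n : ℕ) → S n → Sample n → ℕ → Placement n}
  (hR : ∀ n s, IsExecution (R n s))
include hR

theorem boundedExpectation_ballBits :
    BoundedExpectation (S := S) fun n s v ω => ballBits (R n s ω) v := by
  obtain ⟨n₀, hn₀⟩ := Filter.eventually_atTop.1
    ((eventually_le_logb 4).and eventually_mul_sqrt_roundError_le)
  exact ⟨1662, n₀, fun n _ hn s v =>
    (hR n s).lintegral_ballBits_le (hn₀ n hn).1 (hn₀ n hn).2 v⟩

theorem guarantees_of_isExecution : Guarantees S R := by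
  obtain ⟨C, n₀, hC⟩ := boundedExpectation_ballBits hR
  have hsent : ∀ (n : ℕ) [NeZero n], n₀ ≤ n → ∀ s v, ∫⁻ ω, ballSent (R n s ω) v ∂law n ≤ C :=
    fun n _ hn s v => (lintegral_mono fun ω => ballSent_le_ballBits (R n s) ω v).trans (hC n hn s v)
  have hrec : ∀ (n : ℕ) [NeZero n], n₀ ≤ n → ∀ s v, ∫⁻ ω, ballReceived (R n s ω) v ∂law n ≤ C :=
    fun n _ hn s v =>
      (lintegral_mono fun ω => ballReceived_le_ballSent (R n s) ω v).trans (hsent n hn s v)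
  have hbin : ∀ (n : ℕ) [NeZero n], n₀ ≤ n → ∀ s w, ∫⁻ ω, binSent (R n s ω) ω w ∂law n ≤ C :=
    fun n _ hn s w => (hR n s).lintegral_binSent_le (hrec n hn s) w
  refine
    { rounds := whp_of_typical hR fun r => ⟨25 + r, 0, fun n _ _ hL m hm s ω hω v hv => ?_⟩
      maxLoad := fun n s => (hR n s).load_le
      perRound := whp_of_typical hR fun r => ⟨0, 0, fun n _ _ hL m hm s ω hω i => ?_⟩
      total := whp_of_typical hR fun r => ⟨3 * (41 + 2 * r), 0, fun n _ _ hL m hm s ω hω =>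
        totalSent_le_of_typical hL hm (hR n s) hω⟩
      ballSent_exp := ⟨C, n₀, hsent⟩
      ballReceived_exp := ⟨C, n₀, hrec⟩
      ball_whp := whp_of_typical hR fun r => ⟨2 * (11 + r), 0, fun n _ _ hL m hm s ω hω v => ?_⟩
      binSent_exp := ⟨C, n₀, hbin⟩
      binReceived_exp := ⟨2 * C, n₀, fun n _ hn s w => ?_⟩
      bin_whp := whp_bins hR }
  · have := hm.le_logStar
    exact hω.2 v ((hR n s).eq_none_of_le (by omega) hv)
  · have h := mul_numReq_le_of_typical hL hm (hR n s) hω i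
    refine ⟨(sum_requestsOf _ ω i).trans_le h, (sum_requestsAt _ ω i).trans_le h, ?_⟩
    refine (Finset.sum_le_sum fun v _ => (hR n s).noticesOf_le_requestsOf ω v i).trans ?_
    exact (sum_requestsOf _ ω i).trans_le h
  · have h := ballReceived_le_of_typical hL hm (hR n s) hω v
    have h2 : 2 * ENNReal.ofReal ((11 + r) * Real.logb 2 n) =
        ENNReal.ofReal ((2 * (11 + r) : ℕ) * Real.logb 2 n) := by
      rw [← ENNReal.ofReal_ofNat, ← ENNReal.ofReal_mul (by norm_num)]
      congr 1; push_cast; ring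
    have h3 := ((hR n s).ballSent_le ω v).trans (mul_le_mul_right h 2)
    rw [h2] at h3
    exact ⟨h3, (ballReceived_le_ballSent (R n s) ω v).trans h3⟩
  · refine (lintegral_mono fun ω => (hR n s).binReceived_le ω w).trans ?_
    rw [lintegral_const_mul' _ _ (by simp)]
    push_cast
    exact mul_le_mul_right (hbin n hn s w) 2

theorem smallMessages_of_isExecution : SmallMessages S R where
  size_exp := boundedExpectation_ballBits hR
  size_whp := whp_of_typical hR fun r => ⟨29 + r, 0, fun n _ _ hL m hm s ω hω i v hpos => by
    have hi : i < m + r := by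
      by_contra h
      have h1 := requestsOf_eq_zero_of_typical (hR n s) hω (not_lt.1 h) v
      have h2 := (hR n s).noticesOf_le_requestsOf ω v i
      omega
    have := hm.le_logStar
    exact messageSize_le_mul_logb_logStar hL (by omega)⟩

end Family

end BallsBins

theorem mainTheorem3 :
    BallsBins.Guarantees BallsBins.ChoiceRule (fun _ σ ω => BallsBins.run σ ω) ∧
    BallsBins.Guarantees BallsBins.Schedule (fun _ τ ω => BallsBins.asyncRun τ ω) ∧
    BallsBins.SmallMessages BallsBins.Schedule (fun _ τ ω => BallsBins.asyncRun τ ω) :=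
  ⟨BallsBins.guarantees_of_isExecution fun _ σ => BallsBins.isExecution_run σ,
    BallsBins.guarantees_of_isExecution fun _ τ => BallsBins.isExecution_asyncRun τ,
    BallsBins.smallMessages_of_isExecution fun _ τ => BallsBins.isExecution_asyncRun τ⟩
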